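/- Let $S$ be a finite non-empty set and let $p:2^S\to\mathbb Z\cup\{-\infty\}$ be a supermodular function, i.e. $p(X)+p(Y)\le p(X\cap Y)+p(X\cup Y)$ whenever $p(X),p(Y)$ are finite, with $p(\emptyset)=0$ and $p(S)$ finite. For $x\in\mathbb R^S$ put $\widetilde x(Z)=\sum_{s\in Z}x(s)$. Let $B=B'(p)=\{x\in\mathbb R^S:\widetilde x(S)=p(S),\ \widetilde x(Z)\ge p(Z)\ \text{for all } Z\subseteq S\}$ be the integral base-polyhedron defined by $p$ (and use the notation $B'(\cdot)$ likewise for set-functions on other ground-sets), and for a polyhedron $P$ let $\overset{\cdot}{P}$ be the set of its integral elements; thus $\overset{\cdot}{B}$ is an M-convex set. An element $m$ of a set $Q$ of integral vectors is decreasingly minimal (dec-min) in $Q$ if, for every $y\in Q$, the vector $m$ with its components rearranged in decreasing order is lexicographically smaller than or equal to $y$ with its components rearranged in decreasing order. Define the canonical chain $\emptyset=C_0\subset C_1\subset\dots\subset C_q=S$, the canonical partition $\{S_1,\dots,S_q\}$ and the essential value-sequence $\beta_1,\dots,\beta_q$ iteratively. As long as $C_{i-1}\ne S$, let $$\beta_i=\max\Big\{\Big\lceil\frac{p(X\cup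 C_{i-1})-p(C_{i-1})}{|X|}\Big\rceil:\emptyset\ne X\subseteq S\setminus C_{i-1}\Big\},$$ let $S_i$ be the smallest subset $X$ of $S\setminus C_{i-1}$ maximizing $p(X\cup C_{i-1})-p(C_{i-1})-(\beta_i-1)|X|$, and let $C_i=C_{i-1}\cup S_i$. Let $p_i(X)=p(X\cup C_{i-1})-p(C_{i-1})$ for $X\subseteq S_i$, and $r_i=p_i(S_i)-(\beta_i-1)|S_i|$. Let $B^{\bullet}$ be the set of those $x\in B$ for which $\widetilde x(C_i)=p(C_i)$ for all $i$, and $\beta_i-1\le x(s)\le\beta_i$ for all $i$ and all $s\in S_i$. Let $\Delta^*\in\mathbb Z^S$ be given by $\Delta^*(s)=\beta_i-1$ for $s\in S_i$. Then, for every $i=1,\dots,q$, the sets $\{s\in S_i: m_i(s)=\beta_i\}$, where $m_i$ runs over the dec-min elements of the set of integral elements of $B'(p_i)\subseteq\mathbb R^{S_i}$, are the bases of a matroid $M_i$ on ground-set $S_i$; and a set $L\subseteq S_i$ is a basis of $M_i$ if and only if $|L|=r_i$ and $|L\cap X|\ge p_i(X)-(\beta_i-1)|X|$ for every $X\subseteq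 S_i$. Let $M^*$, a matroid on $S$, be the direct sum of $M_1,\dots,M_q$. Then: 1. a vector $m\in\mathbb Z^S$ is a dec-min element of $\overset{\cdot}{B}$ if and only if $m=\chi_L+\Delta^*$ for some basis $L$ of $M^*$, where $\chi_L$ is the characteristic vector of $L$; 2. $B^{\bullet}$ is the translation by $\Delta^*$ of the base-polyhedron $\{x\in\mathbb R^S:\widetilde x(S)=r(S),\ \widetilde x(Z)\le r(Z)\ \text{for all } Z\subseteq S\}$ of $M^*$, where $r$ is the rank function of $M^*$; 3. the set of dec-min elements of $\overset{\cdot}{B}$ is $\overset{\cdot}{B^{\bullet}}$; in particular it is a matroidal M-convex set, that is, the set of integral elements of the translation of the base-polyhedron of a matroid on $S$ by an integral vector. -/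

import Mathlib

open Finset

namespace DecMinBase

section Vectors

variable {S : Type*} [Fintype S]

/-- The components of an integral vector, rearranged in decreasing order. -/
def decSort (x : S → ℤ) : List ℤ := ((univ : Finset S).val.map x).sort (· ≥ ·)

/-- `x ≤_dec y`: either `x` and `y` are value-equivalent, or at the first position where the
decreasing rearrangements differ, that of `x` is smaller. -/
def DecLE (x y : S → ℤ) : Prop :=
  decSort x = decSort y ∨ List.Lex (· < ·) (decSort x) (decSort y)

/-- `m` is a decreasingly minimal element of the set `Q` of integral vectors. -/
def IsDecMin (Q : Set (S → ℤ)) (m : S → ℤ) : Prop := m ∈ Q ∧ ∀ y ∈ Q, DecLE m y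

/-- The integral elements of a set of real vectors. -/
def intPoints (P : Set (S → ℝ)) : Set (S → ℤ) := {z | (fun s => (z s : ℝ)) ∈ P}

/-- The base-polyhedron `{x : x(S) = r(S), x(Z) ≤ r(Z) for all Z ⊆ S}` of a matroid with rank
function `r` (used for matroids whose ground set is the whole type). -/
def matroidBasePolyhedron (M : Matroid S) : Set (S → ℝ) :=
  {x | ∑ s, x s = ((M.eRk Set.univ).toNat : ℝ) ∧
    ∀ Z : Finset S, ∑ s ∈ Z, x s ≤ ((M.eRk (Z : Set S)).toNat : ℝ)}

/-- The translation of a set of real vectors by an integral vector. -/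
def translate (d : S → ℤ) (P : Set (S → ℝ)) : Set (S → ℝ) :=
  (fun x s => x s + (d s : ℝ)) '' P

/-- A matroidal M-convex set: the set of integral elements of the translation of a matroid
base-polyhedron by an integral vector. -/
def IsMatroidalMConvex (A : Set (S → ℤ)) : Prop :=
  ∃ (M : Matroid S) (d : S → ℤ), M.E = Set.univ ∧
    A = intPoints (translate d (matroidBasePolyhedron M))

end Vectors

section SetFunctions

variable {S : Type*} [Fintype S] [DecidableEq S]

/-- A (fully) supermodular set-function with values in `ℤ ∪ {-∞}`, zero on the empty set and
finite on the whole ground-set. Since `⊥ + a = ⊥`, the inequality is a restriction only on pairs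
of sets with finite values. -/
structure IsSupermodular (p : Finset S → WithBot ℤ) : Prop where
  map_empty : p ∅ = 0
  map_univ_ne_bot : p univ ≠ ⊥
  supermodular : ∀ X Y : Finset S, p X + p Y ≤ p (X ∩ Y) + p (X ∪ Y)

/-- The base-polyhedron `B'(p) = {x : x(S) = p(S), x(Z) ≥ p(Z) for all Z ⊆ S}`. -/
def basePolyhedron (p : Finset S → WithBot ℤ) : Set (S → ℝ) :=
  {x | (p univ).map (fun a : ℤ => (a : ℝ)) = ((∑ s, x s : ℝ) : WithBot ℝ) ∧
    ∀ Z : Finset S, (p Z).map (fun a : ℤ => (a : ℝ)) ≤ ((∑ s ∈ Z, x s : ℝ) : WithBot ℝ)}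

/-- The contraction `p / C`, that is `X ↦ p(X ∪ C) - p(C)`, evaluated at sets `X` disjoint from
`C` (only used when `p C` is finite). -/
def contract (p : Finset S → WithBot ℤ) (C X : Finset S) : WithBot ℤ :=
  (p (X ∪ C)).map (fun a => a - (p C).unbotD 0)

/-- `max {⌈(p(X ∪ C) - p(C)) / |X|⌉ : ∅ ≠ X ⊆ S - C}` (only used when `C ≠ S`). -/
def beta (p : Finset S → WithBot ℤ) (C : Finset S) : ℤ :=
  ((Cᶜ.powerset.filter Finset.Nonempty).sup
    (fun X => (contract p C X).map (fun a : ℤ => ⌈(a : ℚ) / (#X : ℚ)⌉))).unbotD 0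

/-- The function `h(X) = (p / C)(X) - (β - 1) |X|` on the subsets of `S - C`, where
`β = beta p C`. -/
def excess (p : Finset S → WithBot ℤ) (C X : Finset S) : WithBot ℤ :=
  (contract p C X).map (fun a : ℤ => a - (beta p C - 1) * (#X : ℤ))

/-- The subsets of `S - C` that maximize `excess p C`. -/
def maximizers (p : Finset S → WithBot ℤ) (C : Finset S) : Finset (Finset S) :=
  Cᶜ.powerset.filter (fun X => ∀ Y ∈ Cᶜ.powerset, excess p C Y ≤ excess p C X)

/-- The peak-set of `S - C` with respect to `p / C`: the intersection of all the maximizers of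
`excess p C` (for supermodular `p` it is the smallest maximizer, see `peak_mem_maximizers`). -/
def peak (p : Finset S → WithBot ℤ) (C : Finset S) : Finset S := (maximizers p C).inf id

/-- The canonical chain `∅ = C₀ ⊂ C₁ ⊂ ⋯ ⊂ C_q = S`, constant after `S` is reached. -/
def chain (p : Finset S → WithBot ℤ) : ℕ → Finset S
  | 0 => ∅
  | j + 1 => chain p j ∪ peak p (chain p j)

/-- The number `q` of the members of the canonical partition. -/
noncomputable def numParts (p : Finset S → WithBot ℤ) : ℕ := sInf {j | chain p j = univ}

/-- The canonical partition, indexed from zero: `part p j` is the peak-set `S_{j+1}` of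
`S - C_j`. -/
def part (p : Finset S → WithBot ℤ) (j : ℕ) : Finset S := peak p (chain p j)

/-- The essential value-sequence, indexed from zero: `value p j` is `β_{j+1}`. -/
def value (p : Finset S → WithBot ℤ) (j : ℕ) : ℤ := beta p (chain p j)

/-- The restriction of `p / C_j` to the subsets of `S_{j+1}`; this is `p_{j+1}`. -/
def partFun (p : Finset S → WithBot ℤ) (j : ℕ) : Finset (part p j) → WithBot ℤ :=
  fun X => contract p (chain p j) (X.map (Function.Embedding.subtype _))

/-- The face `B⊕` of `B'(p)` defined by the canonical chain. -/
def canonicalFace (p : Finset S → WithBot ℤ) : Set (S → ℝ) :=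
  {x | x ∈ basePolyhedron p ∧ ∀ j ≤ numParts p,
    (p (chain p j)).map (fun a : ℤ => (a : ℝ)) = ((∑ s ∈ chain p j, x s : ℝ) : WithBot ℝ)}

/-- The box `T*`: `β_i - 1 ≤ x(s) ≤ β_i` for every `s ∈ S_i`. -/
def canonicalBox (p : Finset S → WithBot ℤ) : Set (S → ℝ) :=
  {x | ∀ j < numParts p, ∀ s ∈ part p j, (value p j : ℝ) - 1 ≤ x s ∧ x s ≤ (value p j : ℝ)}

/-- The polyhedron `B• = B⊕ ∩ T*`. -/
def bullet (p : Finset S → WithBot ℤ) : Set (S → ℝ) := canonicalFace p ∩ canonicalBox p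

/-- The vector `Δ*`, equal to `β_i - 1` on `S_i`. -/
noncomputable def shift (p : Finset S → WithBot ℤ) (s : S) : ℤ :=
  ∑ j ∈ range (numParts p), if s ∈ part p j then value p j - 1 else 0

/-- The family `{L(m) : m a dec-min integral element of B'(p_{j+1})}` of subsets of `S_{j+1}`,
where `L(m)` is the set of elements `s` with `m(s) = β_{j+1}`. -/
def topSets (p : Finset S → WithBot ℤ) (j : ℕ) : Set (Set S) :=
  {L | ∃ m : part p j → ℤ, IsDecMin (intPoints (basePolyhedron (partFun p j))) m ∧
    L = {s | ∃ h : s ∈ part p j, m ⟨s, h⟩ = value p j}}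

theorem peak_subset_compl (p : Finset S → WithBot ℤ) (C : Finset S) : peak p C ⊆ Cᶜ := by
  classical
  have hne : Cᶜ.powerset.Nonempty := ⟨∅, by simp⟩
  obtain ⟨X, hX, hmax⟩ := exists_max_image Cᶜ.powerset (excess p C) hne
  have hXm : X ∈ maximizers p C := by
    simp only [maximizers, mem_filter]; exact ⟨hX, hmax⟩
  exact (Finset.inf_le (f := id) hXm).trans (mem_powerset.mp hX)

theorem contract_supermodular {p : Finset S → WithBot ℤ} (hp : IsSupermodular p)
    (C X Y : Finset S) :
    contract p C X + contract p C Y ≤ contract p C (X ∩ Y) + contract p C (X ∪ Y) := by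
  have h := hp.supermodular (X ∪ C) (Y ∪ C)
  have e1 : (X ∪ C) ∩ (Y ∪ C) = (X ∩ Y) ∪ C := by ext; simp; tauto
  have e2 : (X ∪ C) ∪ (Y ∪ C) = (X ∪ Y) ∪ C := by ext; simp; tauto
  rw [e1, e2] at h
  unfold contract
  generalize p (X ∪ C) = a at h ⊢
  generalize p (Y ∪ C) = b at h ⊢
  generalize p (X ∩ Y ∪ C) = c at h ⊢
  generalize p (X ∪ Y ∪ C) = d at h ⊢
  generalize (p C).unbotD 0 = e
  induction a <;> induction b <;> induction c <;> induction d <;>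
    simp_all [← WithBot.coe_add]
  linarith

theorem excess_supermodular {p : Finset S → WithBot ℤ} (hp : IsSupermodular p)
    (C X Y : Finset S) :
    excess p C X + excess p C Y ≤ excess p C (X ∩ Y) + excess p C (X ∪ Y) := by
  have h := contract_supermodular hp C X Y
  have hc : (#(X ∩ Y) : ℤ) + #(X ∪ Y) = #X + #Y := by
    exact_mod_cast card_inter_add_card_union X Y
  unfold excess
  generalize contract p C X = a at h ⊢
  generalize contract p C Y = b at h ⊢
  generalize contract p C (X ∩ Y) = c at h ⊢
  generalize contract p C (X ∪ Y) = d at h ⊢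
  generalize beta p C - 1 = e
  induction a <;> induction b <;> induction c <;> induction d <;>
    simp_all [← WithBot.coe_add]
  linear_combination h + e * hc

theorem peak_mem_maximizers {p : Finset S → WithBot ℤ} (hp : IsSupermodular p)
    (C : Finset S) : peak p C ∈ maximizers p C := by
  classical
  have hne : Cᶜ.powerset.Nonempty := ⟨∅, by simp⟩
  obtain ⟨X, hX, hmax⟩ := exists_max_image Cᶜ.powerset (excess p C) hne
  have hXm : (maximizers p C).Nonempty := ⟨X, by
    simp only [maximizers, mem_filter]; exact ⟨hX, hmax⟩⟩
  unfold peak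
  rw [← inf'_eq_inf hXm]
  refine inf'_induction hXm id ?_ (fun b hb => hb)
  intro A hA B hB
  simp only [maximizers, mem_filter, mem_powerset] at hA hB ⊢
  have hI : A ∩ B ⊆ Cᶜ := inter_subset_left.trans hA.1
  refine ⟨hI, fun Y hY => (hA.2 Y hY).trans ?_⟩
  have h1 := excess_supermodular hp C A B
  have h2 := hA.2 _ (union_subset hA.1 hB.1)
  have h3 := hA.2 _ hB.1
  have h4 := hB.2 _ hA.1
  have h5 := hA.2 _ (subset_refl Cᶜ)
  have h6 : excess p C Cᶜ ≠ ⊥ := by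
    have := hp.map_univ_ne_bot
    simpa [excess, contract, WithBot.map_eq_bot_iff, union_comm Cᶜ C] using this
  have h7 : excess p C B = excess p C A := le_antisymm h3 h4
  rw [h7] at h1
  change excess p C A ≤ excess p C (A ∩ B)
  generalize excess p C A = a at *
  generalize excess p C (A ∩ B) = c at *
  generalize excess p C (A ∪ B) = d at *
  generalize excess p C Cᶜ = e at *
  induction a <;> induction c <;> induction d <;> induction e <;>
    simp_all [← WithBot.coe_add]
  linarith

theorem excess_peak_ne_bot {p : Finset S → WithBot ℤ} (hp : IsSupermodular p)
    (C : Finset S) : p (peak p C ∪ C) ≠ ⊥ := by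
  have h := peak_mem_maximizers hp C
  simp only [maximizers, mem_filter, mem_powerset] at h
  have h5 := h.2 _ (subset_refl Cᶜ)
  have h6 : excess p C Cᶜ ≠ ⊥ := by
    have := hp.map_univ_ne_bot
    simpa [excess, contract, WithBot.map_eq_bot_iff, union_comm Cᶜ C] using this
  intro h7
  have : excess p C (peak p C) = ⊥ := by simp [excess, contract, h7]
  rw [this] at h5
  exact h6 (le_bot_iff.mp h5)

theorem chain_ne_bot {p : Finset S → WithBot ℤ} (hp : IsSupermodular p) (j : ℕ) :
    p (chain p j) ≠ ⊥ := by
  induction j with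
  | zero => simp [chain, hp.map_empty]
  | succ j _ => rw [chain, union_comm]; exact excess_peak_ne_bot hp _

theorem peak_nonempty {p : Finset S → WithBot ℤ} (hp : IsSupermodular p)
    {C : Finset S} (hC : p C ≠ ⊥) (hCS : C ≠ univ) : (peak p C).Nonempty := by
  by_contra hemp
  rw [not_nonempty_iff_eq_empty] at hemp
  have hpk := peak_mem_maximizers hp C
  simp only [maximizers, mem_filter, mem_powerset, hemp] at hpk
  have h0 : excess p C ∅ = 0 := by
    obtain ⟨c, hc⟩ := WithBot.ne_bot_iff_exists.mp hC
    simp [excess, contract, ← hc]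
  have hcne : (Cᶜ).Nonempty := by
    rw [nonempty_iff_ne_empty]; simpa using hCS
  have hne : (Cᶜ.powerset.filter Finset.Nonempty).Nonempty :=
    ⟨Cᶜ, by simp [hcne]⟩
  obtain ⟨X, hX, hsup⟩ := exists_mem_eq_sup _ hne
    (fun X => (contract p C X).map (fun a : ℤ => ⌈(a : ℚ) / (#X : ℚ)⌉))
  have hfin : (contract p C Cᶜ).map (fun a : ℤ => ⌈(a : ℚ) / (#Cᶜ : ℚ)⌉) ≠ ⊥ := by
    have := hp.map_univ_ne_bot
    simpa [contract, WithBot.map_eq_bot_iff, union_comm Cᶜ C] using this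
  have hle := Finset.le_sup (f := fun X => (contract p C X).map
    (fun a : ℤ => ⌈(a : ℚ) / (#X : ℚ)⌉)) (show Cᶜ ∈ Cᶜ.powerset.filter Finset.Nonempty by
      simp [hcne])
  have hXne : contract p C X ≠ ⊥ := by
    intro h
    rw [hsup] at hle
    simp only [h, WithBot.map_bot, le_bot_iff] at hle
    exact hfin hle
  obtain ⟨a, ha⟩ := WithBot.ne_bot_iff_exists.mp hXne
  have hb : beta p C = ⌈(a : ℚ) / (#X : ℚ)⌉ := by
    unfold beta; rw [hsup, ← ha]; rfl
  simp only [mem_filter, mem_powerset] at hX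
  have hXpos : (0 : ℚ) < #X := by exact_mod_cast hX.2.card_pos
  have h1 := hpk.2 X hX.1
  rw [h0] at h1
  have h2 : a - (beta p C - 1) * (#X : ℤ) ≤ 0 := by
    have : excess p C X = ((a - (beta p C - 1) * (#X : ℤ) : ℤ) : WithBot ℤ) := by
      unfold excess; rw [← ha]; rfl
    rw [this] at h1; exact_mod_cast h1
  have h3 := Int.ceil_lt_add_one ((a : ℚ) / (#X : ℚ))
  rw [← hb] at h3
  have h4 : ((beta p C : ℚ) - 1) * #X < a := by
    rw [← lt_div_iff₀ hXpos]; linarith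
  have h5 : (beta p C - 1) * (#X : ℤ) < a := by exact_mod_cast h4
  linarith

theorem le_card_chain {p : Finset S → WithBot ℤ} (hp : IsSupermodular p) (j : ℕ) :
    chain p j = univ ∨ j ≤ #(chain p j) := by
  induction j with
  | zero => simp
  | succ j ih =>
    rw [chain]
    by_cases hu : chain p j = univ
    · left; simp [hu]
    · right
      have hd : Disjoint (chain p j) (peak p (chain p j)) :=
        (subset_compl_iff_disjoint_left).mp (peak_subset_compl p _)
      rw [card_union_of_disjoint hd]
      have := (peak_nonempty hp (chain_ne_bot hp j) hu).card_pos
      have := ih.resolve_left hu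
      omega

/-- The iteration terminates: the canonical partition covers the ground-set. -/
theorem chain_numParts {p : Finset S → WithBot ℤ} (hp : IsSupermodular p) :
    chain p (numParts p) = univ := by
  refine Nat.sInf_mem (s := {j | chain p j = univ}) ⟨Fintype.card S, ?_⟩
  rcases le_card_chain hp (Fintype.card S) with h | h
  · exact h
  · exact (card_eq_iff_eq_univ _).mp (le_antisymm (card_le_univ _) h)

end SetFunctions

end DecMinBase

open DecMinBase

/-! Subtracting `β_i - 1` on `S_i` turns the problem on each part into one about the supermodular
function `h = excess p C_{i-1}`. The choice of `β_i` gives `h(X) ≤ |X|` (`excess_le_card`), and the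
choice of the peak-set makes `S_i` a maximizer of `h`. Sets that are tight for a 0-1 vector meeting
the bounds of `h` are closed under intersection and union. This uncrossing shows that 0-1 bases
exist (`exists_isLowerBase`), that they satisfy base exchange (`IsLowerBase.exchange`), and hence
that they form a matroid.

The maximality of the peak also makes the `β_i` strictly decrease. Let `z` be integral in `B•` and
`x` integral in `B`, and move up the chain. While the two agree in value distribution and sum on
`C_{j-1}`, the equality `z(C_j) = p(C_j) ≤ x(C_j)` gives `x(S_j) ≥ z(S_j)`. On `S_j` the vector `z`
takes only the values `β_j - 1` and `β_j`, and beyond `C_j` it stays below `β_j`. So either `x` lies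
in the same box with the same sum on `S_j`, or it has more large components (`box_or_lex`). Thus the
dec-min elements are the integral points of `B•` (`bullet_or_lex`).

Finally, supermodularity splits the canonical face into the base-polyhedra of the `p_i`
(`mem_canonicalFace_iff`). Uncrossing again bounds `y(Z)` by `|L ∩ Z|` for some 0-1 base `L`
(`exists_isLowerBase_sum_le`); complementing sets turns rank bounds back into lower bounds. -/

namespace DecMinBase

/-! ### 0-1 bases of a supermodular function and their tight sets. -/

section LowerBases

variable {S : Type*} [DecidableEq S]

/-- `L ⊆ E` meets all the lower bounds that `h` prescribes on the subsets of `E`. -/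
def MeetsBounds (h : Finset S → WithBot ℤ) (E L : Finset S) : Prop :=
  ∀ X ⊆ E, h X ≤ ((#(L ∩ X) : ℤ) : WithBot ℤ)

/-- A subset of `E` whose characteristic vector lies in the base-polyhedron of `h`
on ground-set `E`. -/
def IsLowerBase (h : Finset S → WithBot ℤ) (E L : Finset S) : Prop :=
  L ⊆ E ∧ h E = ((#L : ℤ) : WithBot ℤ) ∧ MeetsBounds h E L

/-- The subsets of `E` for which the lower bound prescribed by `h` holds with equality. -/
def IsTight (h : Finset S → WithBot ℤ) (E L X : Finset S) : Prop :=
  X ⊆ E ∧ h X = ((#(L ∩ X) : ℤ) : WithBot ℤ)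

variable {h : Finset S → WithBot ℤ} {E L : Finset S}

/-- Uncrossing: `X ↦ |L ∩ X|` is modular and `h` is supermodular, so equality at `X` and `Y` leaves
no slack at `X ∩ Y` and `X ∪ Y`. -/
theorem IsTight.inter_union
    (hsup : ∀ X Y : Finset S, h X + h Y ≤ h (X ∩ Y) + h (X ∪ Y))
    (hL : MeetsBounds h E L) {X Y : Finset S} (hX : IsTight h E L X) (hY : IsTight h E L Y) :
    IsTight h E L (X ∩ Y) ∧ IsTight h E L (X ∪ Y) := by
  have hI : X ∩ Y ⊆ E := inter_subset_left.trans hX.1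
  have hU : X ∪ Y ⊆ E := union_subset hX.1 hY.1
  have h1 := hL _ hI
  have h2 := hL _ hU
  have h3 := hsup X Y
  rw [hX.2, hY.2] at h3
  have hc : (#(L ∩ (X ∩ Y)) : ℤ) + #(L ∩ (X ∪ Y)) = #(L ∩ X) + #(L ∩ Y) := by
    have := card_inter_add_card_union (L ∩ X) (L ∩ Y)
    rw [← inter_union_distrib_left, ← inter_inter_distrib_left] at this
    exact_mod_cast this
  refine ⟨⟨hI, ?_⟩, ⟨hU, ?_⟩⟩
  all_goals
    generalize h (X ∩ Y) = a at *
    generalize h (X ∪ Y) = b at *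
    induction a <;> induction b <;> simp_all [← WithBot.coe_add]
    rw [← Int.cast_natCast, Int.cast_id] at *
    norm_cast at *
    omega

/-- If every `e ∈ A` is in a tight set avoiding `F`, then `A` is in a tight set avoiding `F`. -/
theorem exists_isTight_superset
    (hsup : ∀ X Y : Finset S, h X + h Y ≤ h (X ∩ Y) + h (X ∪ Y)) (h0 : h ∅ = 0)
    (hL : MeetsBounds h E L) (F A : Finset S)
    (hA : ∀ e ∈ A, ∃ X, IsTight h E L X ∧ e ∈ X ∧ Disjoint X F) :
    ∃ X, IsTight h E L X ∧ A ⊆ X ∧ Disjoint X F := by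
  induction A using Finset.induction_on with
  | empty => exact ⟨∅, ⟨by simp, by simp [h0]⟩, by simp, by simp⟩
  | insert a A _ ih =>
    obtain ⟨X, hX, hAX, hXF⟩ := ih fun e he => hA e (mem_insert_of_mem he)
    obtain ⟨Y, hY, haY, hYF⟩ := hA a (mem_insert_self _ _)
    refine ⟨Y ∪ X, (hY.inter_union hsup hL hX).2, ?_, disjoint_union_left.2 ⟨hYF, hXF⟩⟩
    exact insert_subset (mem_union_left _ haY) (hAX.trans subset_union_right)

/-- If `e` is in a tight set avoiding `f` for every `f ∈ F`, then `e` is in a tight set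
avoiding `F`. -/
theorem exists_isTight_disjoint
    (hsup : ∀ X Y : Finset S, h X + h Y ≤ h (X ∩ Y) + h (X ∪ Y))
    (hL : IsLowerBase h E L) {e : S} (he : e ∈ L) (F : Finset S)
    (hF : ∀ f ∈ F, ∃ X, IsTight h E L X ∧ e ∈ X ∧ f ∉ X) :
    ∃ X, IsTight h E L X ∧ e ∈ X ∧ Disjoint X F := by
  induction F using Finset.induction_on with
  | empty =>
    -- `E` itself is tight because `h(E) = |L|`; for mere `MeetsBounds` there would be no starting
    -- set.
    exact ⟨E, ⟨Subset.rfl, by rw [hL.2.1, inter_eq_left.2 hL.1]⟩, hL.1 he, by simp⟩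
  | insert a A _ ih =>
    obtain ⟨X, hX, heX, hXA⟩ := ih fun f hf => hF f (mem_insert_of_mem hf)
    obtain ⟨Y, hY, heY, haY⟩ := hF a (mem_insert_self _ _)
    refine ⟨Y ∩ X, (hY.inter_union hsup hL.2.2 hX).1, mem_inter.2 ⟨heY, heX⟩, ?_⟩
    rw [disjoint_insert_right]
    exact ⟨fun h => haY (mem_inter.1 h).1, hXA.mono_left inter_subset_right⟩

/-- Either `L - e + f` is again a lower base, or a tight set separates `e` from `f`. -/
theorem IsLowerBase.exchange_or_exists_isTight (hL : IsLowerBase h E L) {e f : S}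
    (he : e ∈ L) (hf : f ∉ L) (hfE : f ∈ E) :
    IsLowerBase h E (insert f (L.erase e)) ∨ ∃ X, IsTight h E L X ∧ e ∈ X ∧ f ∉ X := by
  by_contra! hcon
  obtain ⟨hnb, hsep⟩ := hcon
  have hfe : f ∉ L.erase e := fun h => hf (mem_of_mem_erase h)
  refine hnb ⟨insert_subset hfE ((erase_subset _ _).trans hL.1), ?_, fun X hX => ?_⟩
  · rw [hL.2.1, card_insert_of_notMem hfe, card_erase_add_one he]
  · by_cases hfX : f ∈ X
    · refine (hL.2.2 X hX).trans ?_
      have : #(L ∩ X) ≤ #(insert f (L.erase e) ∩ X) := by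
        have h1 : insert f ((L ∩ X).erase e) ⊆ insert f (L.erase e) ∩ X := by
          intro s hs; simp only [mem_insert, mem_erase, mem_inter] at hs ⊢
          rcases hs with rfl | hs
          · exact ⟨Or.inl rfl, hfX⟩
          · exact ⟨Or.inr ⟨hs.1, hs.2.1⟩, hs.2.2⟩
        have h2 := card_le_card h1
        rw [card_insert_of_notMem (by simp [hf])] at h2
        have := pred_card_le_card_erase (s := L ∩ X) (a := e)
        omega
      exact_mod_cast this
    -- Only sets containing `e` but not `f` can lose an element, and they lose just one. By
    -- assumption they are not tight, so integrality leaves room for it.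
    · by_cases heX : e ∈ X
      · have hlt : h X ≠ ((#(L ∩ X) : ℤ) : WithBot ℤ) := fun hh =>
          hfX (hsep X ⟨hX, hh⟩ heX)
        have hle := lt_of_le_of_ne (hL.2.2 X hX) hlt
        have h1 : (L ∩ X).erase e ⊆ insert f (L.erase e) ∩ X := by
          intro s hs; simp only [mem_insert, mem_erase, mem_inter] at hs ⊢; tauto
        have h2 := card_le_card h1
        have h3 := card_erase_add_one (mem_inter.2 ⟨he, heX⟩)
        generalize h X = a at *
        induction a with
        | bot => exact bot_le
        | coe a =>
          rw [WithBot.coe_lt_coe] at hle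
          rw [WithBot.coe_le_coe]
          omega
      · refine (hL.2.2 X hX).trans ?_
        have : #(L ∩ X) ≤ #(insert f (L.erase e) ∩ X) := by
          refine card_le_card fun s hs => ?_
          simp only [mem_insert, mem_erase, mem_inter] at hs ⊢
          exact ⟨Or.inr ⟨fun h => heX (h ▸ hs.2), hs.1⟩, hs.2⟩
        exact_mod_cast this

/-- If every exchange fails, the separating tight sets intersect in a tight `T` that contains `e`
and avoids `L' \ L`. Then `L' ∩ T` is properly contained in `L ∩ T`, so `L'` violates its bound at
`T`. -/
theorem IsLowerBase.exchange
    (hsup : ∀ X Y : Finset S, h X + h Y ≤ h (X ∩ Y) + h (X ∪ Y))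
    {L' : Finset S} (hL : IsLowerBase h E L) (hL' : IsLowerBase h E L') {e : S}
    (he : e ∈ L \ L') : ∃ f ∈ L' \ L, IsLowerBase h E (insert f (L.erase e)) := by
  rw [mem_sdiff] at he
  by_contra! hcon
  obtain ⟨T, hT, heT, hdis⟩ := exists_isTight_disjoint hsup hL he.1 (L' \ L) fun f hf =>
    (hL.exchange_or_exists_isTight he.1 (mem_sdiff.1 hf).2
      (hL'.1 (mem_sdiff.1 hf).1)).resolve_left (hcon f hf)
  have h1 := hL'.2.2 T hT.1
  rw [hT.2] at h1
  have h2 : L' ∩ T ⊂ L ∩ T := by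
    rw [ssubset_iff_of_subset]
    · exact ⟨e, mem_inter.2 ⟨he.1, heT⟩, fun h => he.2 (mem_inter.1 h).1⟩
    · intro s hs
      rw [mem_inter] at hs ⊢
      refine ⟨by_contra fun hsL => ?_, hs.2⟩
      exact disjoint_left.1 hdis hs.2 (mem_sdiff.2 ⟨hs.1, hsL⟩)
  have h3 := card_lt_card h2
  have h4 : (#(L ∩ T) : ℤ) ≤ #(L' ∩ T) := by exact_mod_cast h1
  omega

/-- Take `L` of least cardinality meeting the bounds; `E` is a candidate by `hcard`. Minimality puts
each element of `L` in a tight set, so the union `T` of these is tight and contains `L`. Then `|L| =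
h(T) ≤ h(E) ≤ |L|`. -/
theorem exists_isLowerBase
    (hsup : ∀ X Y : Finset S, h X + h Y ≤ h (X ∩ Y) + h (X ∪ Y)) (h0 : h ∅ = 0)
    (hcard : ∀ X ⊆ E, h X ≤ ((#X : ℤ) : WithBot ℤ)) (hmax : ∀ X ⊆ E, h X ≤ h E) :
    ∃ L, IsLowerBase h E L := by
  classical
  have hne : (E.powerset.filter (MeetsBounds h E)).Nonempty := by
    refine ⟨E, mem_filter.2 ⟨by simp, fun X hX => ?_⟩⟩
    rw [inter_eq_right.2 hX]; exact hcard X hX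
  obtain ⟨L, hL, hmin⟩ := exists_min_image _ card hne
  simp only [mem_filter, mem_powerset] at hL hmin
  obtain ⟨T, hT, hLT, -⟩ := exists_isTight_superset hsup h0 hL.2 ∅ L fun e he => by
    by_contra! hcon
    have hnot : ¬ MeetsBounds h E (L.erase e) := fun hm => by
      have := hmin _ ⟨(erase_subset _ _).trans hL.1, hm⟩
      have := card_erase_lt_of_mem he
      omega
    refine hnot fun X hX => ?_
    by_cases heX : e ∈ X
    · have hlt := lt_of_le_of_ne (hL.2 X hX) fun hh => hcon X ⟨hX, hh⟩ heX (by simp)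
      have h3 := card_erase_add_one (mem_inter.2 ⟨he, heX⟩)
      rw [← erase_inter] at h3
      generalize h X = a at *
      induction a with
      | bot => exact bot_le
      | coe a =>
        rw [WithBot.coe_lt_coe] at hlt
        rw [WithBot.coe_le_coe]
        omega
    · rw [erase_inter, erase_eq_of_notMem (by simp [heX])]
      exact hL.2 X hX
  refine ⟨L, hL.1, le_antisymm ?_ ?_, hL.2⟩
  · simpa [inter_eq_left.2 hL.1] using hL.2 E Subset.rfl
  · have := hmax T hT.1
    rwa [hT.2, inter_eq_left.2 hLT] at this

/-- The vectors of the polytope `{y : y(E) = h(E), y ≥ h, 0 ≤ y ≤ 1}` are dominated on every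
`Z ⊆ E` by a lower base. -/
theorem exists_isLowerBase_sum_le
    (hsup : ∀ X Y : Finset S, h X + h Y ≤ h (X ∩ Y) + h (X ∪ Y)) (h0 : h ∅ = 0)
    (hex : ∃ L, IsLowerBase h E L) {y : S → ℝ}
    (hyE : (h E).map (fun a : ℤ => (a : ℝ)) = ((∑ s ∈ E, y s : ℝ) : WithBot ℝ))
    (hy : ∀ X ⊆ E, (h X).map (fun a : ℤ => (a : ℝ)) ≤ ((∑ s ∈ X, y s : ℝ) : WithBot ℝ))
    (hy1 : ∀ s ∈ E, y s ≤ 1) (hy0 : ∀ s ∈ E, 0 ≤ y s) {Z : Finset S} (hZ : Z ⊆ E) :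
    ∃ L, IsLowerBase h E L ∧ ∑ s ∈ Z, y s ≤ (#(L ∩ Z) : ℝ) := by
  classical
  have hne : (E.powerset.filter (IsLowerBase h E)).Nonempty := by
    obtain ⟨L, hL⟩ := hex
    exact ⟨L, mem_filter.2 ⟨mem_powerset.2 hL.1, hL⟩⟩
  obtain ⟨L, hL, hmax⟩ := exists_max_image _ (fun L => #(L ∩ Z)) hne
  simp only [mem_filter, mem_powerset] at hL hmax
  replace hL := hL.2
  refine ⟨L, hL, ?_⟩
  -- As `|L ∩ Z|` is maximal, no element of `L \ Z` can be exchanged for one of `Z \ L`, so some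
  -- tight `T` contains `L \ Z` and avoids `Z \ L`.
  obtain ⟨T, hT, hLT, hdis⟩ := exists_isTight_superset hsup h0 hL.2.2 (Z \ L) (L \ Z)
    fun e he => by
      rw [mem_sdiff] at he
      refine exists_isTight_disjoint hsup hL he.1 _ fun f hf => ?_
      rw [mem_sdiff] at hf
      refine (hL.exchange_or_exists_isTight he.1 hf.2 (hZ hf.1)).resolve_left fun hb => ?_
      have h1 := hmax _ ⟨hb.1, hb⟩
      have h2 : insert f (L ∩ Z) ⊆ insert f (L.erase e) ∩ Z := by
        intro s hs
        simp only [mem_insert, mem_erase, mem_inter] at hs ⊢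
        rcases hs with rfl | hs
        · exact ⟨Or.inl rfl, hf.1⟩
        · exact ⟨Or.inr ⟨fun h => he.2 (h ▸ hs.2), hs.1⟩, hs.2⟩
      have h3 := card_le_card h2
      rw [card_insert_of_notMem (by simp [hf.2])] at h3
      omega
  -- The count to come: `|T ∩ Z| + |L \ Z| = |L ∩ T| ≤ y(T) ≤ |T ∩ Z| + y(E \ Z)`, hence `|L \ Z| ≤
  -- y(E \ Z)`. Subtracting from `|L| = y(E)` gives the claim.
  have h1 := hy T hT.1
  rw [hT.2, WithBot.map_coe, WithBot.coe_le_coe] at h1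
  have hyEr : (#L : ℝ) = ∑ s ∈ E, y s := by
    rw [hL.2.1, WithBot.map_coe, WithBot.coe_inj] at hyE
    exact_mod_cast hyE
  have hsplit : #(L ∩ Z) + #(L \ Z) = #L := card_inter_add_card_sdiff L Z
  have hLTc : #(L ∩ T) = #(T ∩ Z) + #(L \ Z) := by
    rw [← card_inter_add_card_sdiff (L ∩ T) Z]
    congr 2
    · ext s
      simp only [mem_inter]
      refine ⟨fun hs => ⟨hs.1.2, hs.2⟩, fun hs => ⟨⟨by_contra fun hsL => ?_, hs.1⟩, hs.2⟩⟩
      exact disjoint_left.1 hdis hs.1 (mem_sdiff.2 ⟨hs.2, hsL⟩)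
    · ext s
      simp only [mem_inter, mem_sdiff]
      exact ⟨fun hs => ⟨hs.1.1, hs.2⟩, fun hs => ⟨⟨hs.1, hLT (mem_sdiff.2 hs)⟩, hs.2⟩⟩
  have hTZ : ∑ s ∈ T, y s = ∑ s ∈ T ∩ Z, y s + ∑ s ∈ T \ Z, y s :=
    (sum_inter_add_sum_sdiff T Z y).symm
  have hEZ : ∑ s ∈ E, y s = ∑ s ∈ Z, y s + ∑ s ∈ E \ Z, y s := by
    rw [add_comm, sum_sdiff hZ]
  have hle1 : ∑ s ∈ T ∩ Z, y s ≤ #(T ∩ Z) := by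
    have := sum_le_card_nsmul (T ∩ Z) y 1 fun s hs => hy1 s (hT.1 (mem_inter.1 hs).1)
    simpa using this
  have hle2 : ∑ s ∈ T \ Z, y s ≤ ∑ s ∈ E \ Z, y s :=
    sum_le_sum_of_subset_of_nonneg (sdiff_subset_sdiff hT.1 Subset.rfl)
      fun s hs _ => hy0 s (mem_sdiff.1 hs).1
  have e1 : (#(L ∩ T) : ℝ) = #(T ∩ Z) + #(L \ Z) := by exact_mod_cast hLTc
  have e2 : (#(L ∩ Z) : ℝ) + #(L \ Z) = #L := by exact_mod_cast hsplit
  have e3 : (#(L ∩ T) : ℝ) ≤ ∑ s ∈ T, y s := by exact_mod_cast h1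
  linarith

/-- The matroid on ground-set `E` whose bases are the lower bases of `h`. -/
noncomputable def lowerMatroid (h : Finset S → WithBot ℤ) (E : Finset S)
    (hsup : ∀ X Y : Finset S, h X + h Y ≤ h (X ∩ Y) + h (X ∪ Y))
    (hex : ∃ L, IsLowerBase h E L) : Matroid S :=
  Matroid.ofIsBaseOfFinite (E := (E : Set S)) E.finite_toSet
    (fun B => ∃ L : Finset S, B = L ∧ IsLowerBase h E L)
    (let ⟨L, hL⟩ := hex; ⟨L, L, rfl, hL⟩)
    (by
      rintro _ _ ⟨L, rfl, hL⟩ ⟨L', rfl, hL'⟩ e he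
      obtain ⟨f, hf, hb⟩ := hL.exchange hsup hL' (e := e) (by simpa using he)
      exact ⟨f, by simpa using hf, _, by simp, hb⟩)
    (by rintro _ ⟨L, rfl, hL⟩; exact_mod_cast hL.1)

end LowerBases

/-! ### Decreasing order through level counts. -/

section DecreasingOrder

/-- At the first difference the entry `x` of `a` cannot exceed the entry `y` of `b`. If `k ≤ x`, the
threshold `x` is reached in `a` but not in `b`; if `x < k`, nothing left in `b` reaches `k`, against
strictness. -/
theorem lex_of_countP_le {k : ℤ} : ∀ {a b : List ℤ},
    a.Pairwise (· ≥ ·) → b.Pairwise (· ≥ ·) →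
    (∀ l ≥ k, a.countP (l ≤ ·) ≤ b.countP (l ≤ ·)) →
    a.countP (k ≤ ·) < b.countP (k ≤ ·) → List.Lex (· < ·) a b
  | [], [], _, _, _, h => by simp at h
  | [], y :: b, _, _, _, _ => List.Lex.nil
  | x :: a, [], _, _, _, h => by simp at h
  | x :: a, y :: b, ha, hb, hle, hlt => by
    rw [List.pairwise_cons] at ha hb
    have hzero : ∀ l, y < l → (y :: b).countP (l ≤ ·) = 0 := by
      intro l hl
      rw [List.countP_eq_zero]
      intro z hz
      rcases List.mem_cons.1 hz with rfl | hz
      · simpa using hl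
      · have := hb.1 z hz
        simp only [decide_eq_true_eq, not_le]; omega
    rcases lt_trichotomy x y with hxy | rfl | hxy
    · exact List.Lex.rel hxy
    · refine List.Lex.cons (lex_of_countP_le (k := k) ha.2 hb.2 (fun l hl => ?_) ?_)
      · have := hle l hl
        simp only [List.countP_cons] at this; omega
      · simp only [List.countP_cons] at hlt; omega
    · by_cases hk : k ≤ x
      · have h1 := hle x hk
        rw [hzero x hxy] at h1
        simp at h1
      · rw [hzero k (by omega)] at hlt
        omega

variable {S : Type*}

/-- The number of `s ∈ A` with `x s ≥ l`. -/
def levelCount (x : S → ℤ) (l : ℤ) (A : Finset S) : ℕ := #{s ∈ A | l ≤ x s}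

theorem levelCount_union [DecidableEq S] (x : S → ℤ) (l : ℤ) {A B : Finset S} (h : Disjoint A B) :
    levelCount x l (A ∪ B) = levelCount x l A + levelCount x l B := by
  rw [levelCount, filter_union, card_union_of_disjoint (disjoint_filter_filter h)]
  rfl

theorem levelCount_eq_zero {x : S → ℤ} {l : ℤ} {A : Finset S} (h : ∀ s ∈ A, x s < l) :
    levelCount x l A = 0 := by
  rw [levelCount, card_eq_zero, filter_eq_empty_iff]
  exact fun s hs => not_le.2 (h s hs)

theorem levelCount_eq_card {x : S → ℤ} {l : ℤ} {A : Finset S} (h : ∀ s ∈ A, l ≤ x s) :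
    levelCount x l A = #A := by
  rw [levelCount, filter_true_of_mem h]

/-- For an integer `t ≤ b`, one has `t ≤ b - 1 + [t = b]`, with equality exactly when `t ≥ b - 1`.
-/
theorem sum_le_levelCount {x : S → ℤ} {b : ℤ} {A : Finset S} (h : ∀ s ∈ A, x s ≤ b) :
    ∑ s ∈ A, x s ≤ (b - 1) * #A + levelCount x b A ∧
    (∑ s ∈ A, x s = (b - 1) * #A + levelCount x b A → ∀ s ∈ A, b - 1 ≤ x s) := by
  have hpt : ∀ s ∈ A, x s ≤ (b - 1) + if b ≤ x s then 1 else 0 := by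
    intro s hs
    have := h s hs
    split_ifs <;> omega
  have hsum : ∑ s ∈ A, ((b - 1) + if b ≤ x s then 1 else 0) =
      (b - 1) * #A + levelCount x b A := by
    rw [sum_add_distrib, sum_const, nsmul_eq_mul, mul_comm, ← sum_filter]
    simp [levelCount]
  rw [← hsum]
  refine ⟨sum_le_sum hpt, fun he s hs => ?_⟩
  have := (sum_eq_sum_iff_of_le hpt).1 he s hs
  split_ifs at this <;> omega

theorem sum_eq_levelCount {x : S → ℤ} {b : ℤ} {A : Finset S}
    (h : ∀ s ∈ A, b - 1 ≤ x s ∧ x s ≤ b) :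
    ∑ s ∈ A, x s = (b - 1) * #A + levelCount x b A := by
  have hpt : ∀ s ∈ A, x s = (b - 1) + if b ≤ x s then 1 else 0 := by
    intro s hs
    have := h s hs
    split_ifs <;> omega
  rw [sum_congr rfl hpt, sum_add_distrib, sum_const, nsmul_eq_mul, mul_comm, ← sum_filter]
  simp [levelCount]

/-- Vectors with equal sums in a unit box have the same value distribution. -/
theorem levelCount_eq_of_box {x z : S → ℤ} {b : ℤ} {A : Finset S}
    (hx : ∀ s ∈ A, b - 1 ≤ x s ∧ x s ≤ b) (hz : ∀ s ∈ A, b - 1 ≤ z s ∧ z s ≤ b)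
    (hsum : ∑ s ∈ A, x s = ∑ s ∈ A, z s) (l : ℤ) :
    levelCount x l A = levelCount z l A := by
  rcases lt_trichotomy l b with hl | rfl | hl
  · rw [levelCount_eq_card fun s hs => by have := hx s hs; omega,
      levelCount_eq_card fun s hs => by have := hz s hs; omega]
  · rw [sum_eq_levelCount hx, sum_eq_levelCount hz] at hsum
    omega
  · rw [levelCount_eq_zero fun s hs => by have := hx s hs; omega,
      levelCount_eq_zero fun s hs => by have := hz s hs; omega]

variable [Fintype S]

theorem countP_decSort (x : S → ℤ) (l : ℤ) :
    (decSort x).countP (l ≤ ·) = levelCount x l univ := by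
  have h : (decSort x).countP (l ≤ ·) = (((decSort x : List ℤ) : Multiset ℤ)).countP (l ≤ ·) := by
    rw [Multiset.coe_countP]
  rw [h, decSort, Multiset.sort_eq, Multiset.countP_map]
  rfl

theorem pairwise_decSort (x : S → ℤ) : (decSort x).Pairwise (· ≥ ·) :=
  Multiset.pairwise_sort _ _

theorem lex_decSort {x z : S → ℤ} {k : ℤ}
    (hle : ∀ l ≥ k, levelCount z l univ ≤ levelCount x l univ)
    (hlt : levelCount z k univ < levelCount x k univ) :
    List.Lex (· < ·) (decSort z) (decSort x) :=
  lex_of_countP_le (pairwise_decSort z) (pairwise_decSort x)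
    (fun l hl => by simpa only [countP_decSort] using hle l hl)
    (by simpa only [countP_decSort] using hlt)

theorem not_decLE_of_lex {x z : S → ℤ} (h : List.Lex (· < ·) (decSort z) (decSort x)) :
    ¬ DecLE x z := by
  have h' : decSort z < decSort x := h
  rintro (he | hl)
  · exact absurd he.symm h'.ne
  · exact lt_asymm h' hl

/-- The multiplicity of `a` is the difference of the counts at levels `a` and `a + 1`, and sorted
lists with equal multiplicities coincide. -/
theorem decSort_eq_of_levelCount {x z : S → ℤ}
    (h : ∀ l, levelCount z l univ = levelCount x l univ) : decSort z = decSort x := by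
  by_contra hne
  refine hne ((List.perm_iff_count.2 fun a => ?_).eq_of_pairwise'
    (pairwise_decSort z) (pairwise_decSort x))
  have key : ∀ y : S → ℤ, (decSort y).count a + levelCount y (a + 1) univ =
      levelCount y a univ := by
    intro y
    rw [← countP_decSort, ← countP_decSort]
    induction decSort y with
    | nil => simp
    | cons b t ih =>
      simp only [List.count_cons, List.countP_cons, beq_iff_eq, decide_eq_true_eq]
      split_ifs <;> omega
  have h1 := key z
  have h2 := key x
  rw [h, h] at h1
  omega

/-- If `z` is in the unit box below `b` on `E` and below `b` outside `C ∪ E`, then a vector `x`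
with the same value distribution on `C` and with `x(E) ≥ z(E)` is either in the same box with
`x(E) = z(E)`, or larger than `z` in the decreasing order. -/
theorem box_or_lex [DecidableEq S] {x z : S → ℤ} {C E : Finset S} {b : ℤ} (hd : Disjoint C E)
    (hC : ∀ l, levelCount z l C = levelCount x l C)
    (hz : ∀ s ∈ E, b - 1 ≤ z s ∧ z s ≤ b) (hz' : ∀ s ∉ C ∪ E, z s < b)
    (hsum : ∑ s ∈ E, z s ≤ ∑ s ∈ E, x s) :
    ((∀ s ∈ E, b - 1 ≤ x s ∧ x s ≤ b) ∧ ∑ s ∈ E, x s = ∑ s ∈ E, z s) ∨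
      List.Lex (· < ·) (decSort z) (decSort x) := by
  set R := (C ∪ E)ᶜ with hR
  have hCR : Disjoint (C ∪ E) R := disjoint_compl_right
  have hsplit : ∀ (y : S → ℤ) (l : ℤ), levelCount y l univ =
      levelCount y l C + levelCount y l E + levelCount y l R := by
    intro y l
    rw [← union_compl (C ∪ E), levelCount_union y l hCR, levelCount_union y l hd]
  have hzR : ∀ l ≥ b, levelCount z l R = 0 := fun l hl =>
    levelCount_eq_zero fun s hs => lt_of_lt_of_le (hz' s (mem_compl.1 hs)) hl
  have hzE : ∀ l > b, levelCount z l E = 0 := fun l hl =>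
    levelCount_eq_zero fun s hs => by have := hz s hs; omega
  by_cases hx : ∀ s ∈ E, x s ≤ b
  · obtain ⟨h1, h2⟩ := sum_le_levelCount hx
    have h3 := sum_eq_levelCount hz
    by_cases hlt : levelCount z b E < levelCount x b E
    · right
      refine lex_decSort (k := b) (fun l hl => ?_) ?_
      · rw [hsplit, hsplit, hC, hzR l hl]
        rcases eq_or_lt_of_le hl with rfl | hl
        · omega
        · rw [hzE l hl]; omega
      · rw [hsplit, hsplit, hC, hzR b le_rfl]; omega
    -- With no more entries `b` than `z`, the sum `x(E)` is at most `z(E)`; equality throughout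
    -- forces `x` into the box.
    · left
      have h4 : (levelCount x b E : ℤ) ≤ levelCount z b E := by exact_mod_cast not_lt.1 hlt
      exact ⟨fun s hs => ⟨h2 (by linarith) s hs, hx s hs⟩, by linarith⟩
  · right
    push Not at hx
    obtain ⟨s, hs, hbs⟩ := hx
    -- Outside `C` no entry of `z` reaches `b + 1`, whereas `x` has one on `E`.
    refine lex_decSort (k := b + 1) (fun l hl => ?_) ?_
    · rw [hsplit, hsplit, hC, hzR l (by omega), hzE l (by omega)]; omega
    · rw [hsplit, hsplit, hC, hzR _ (by omega), hzE _ (by omega)]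
      have : 0 < levelCount x (b + 1) E :=
        card_pos.2 ⟨s, mem_filter.2 ⟨hs, by omega⟩⟩
      omega

end DecreasingOrder

/-! ### Bounds with values in `ℤ ∪ {-∞}` compared with reals. -/

section CastBounds

theorem map_intCast_le_iff {a : WithBot ℤ} {r : ℝ} :
    a.map (fun n : ℤ => (n : ℝ)) ≤ (r : WithBot ℝ) ↔ ∀ n : ℤ, a = n → (n : ℝ) ≤ r := by
  induction a with
  | bot => simp
  | coe a => simp [WithBot.coe_le_coe]

theorem map_intCast_eq_iff {a : WithBot ℤ} {r : ℝ} :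
    a.map (fun n : ℤ => (n : ℝ)) = (r : WithBot ℝ) ↔ ∃ n : ℤ, a = n ∧ (n : ℝ) = r := by
  induction a with
  | bot => simp
  | coe a => simp

end CastBounds

/-! ### The canonical chain, partition and value-sequence. -/

section Chain

variable {S : Type*} [DecidableEq S] {p : Finset S → WithBot ℤ} {C X : Finset S}

theorem contract_eq_coe {a c : ℤ} (ha : p (X ∪ C) = a) (hc : p C = c) :
    contract p C X = ((a - c : ℤ) : WithBot ℤ) := by
  simp [contract, ha, hc]

theorem contract_eq_coe_iff {c n : ℤ} (hc : p C = c) :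
    contract p C X = (n : WithBot ℤ) ↔ p (X ∪ C) = ((n + c : ℤ) : WithBot ℤ) := by
  rw [contract, hc]
  generalize p (X ∪ C) = a
  induction a with
  | bot => simp only [WithBot.map_bot, WithBot.bot_ne_coe]
  | coe a =>
    rw [WithBot.map_coe, WithBot.coe_inj, WithBot.coe_inj, WithBot.unbotD_coe]
    omega

variable [Fintype S]

theorem excess_eq_coe_iff {n : ℤ} :
    excess p C X = (n : WithBot ℤ) ↔
      contract p C X = ((n + (beta p C - 1) * #X : ℤ) : WithBot ℤ) := by
  rw [excess]
  generalize contract p C X = a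
  induction a with
  | bot => simp only [WithBot.map_bot, WithBot.bot_ne_coe]
  | coe a =>
    rw [WithBot.map_coe, WithBot.coe_inj, WithBot.coe_inj]
    constructor <;> intro h <;> linarith

theorem excess_empty (hC : p C ≠ ⊥) : excess p C ∅ = 0 := by
  obtain ⟨c, hc⟩ := WithBot.ne_bot_iff_exists.mp hC
  simp [excess, contract, ← hc]

/-- The default value in `beta` is never used: finiteness of `p(S)` makes the term of the complement
of `C` finite. -/
theorem coe_beta (hp : IsSupermodular p) (hCS : C ≠ univ) :
    (Cᶜ.powerset.filter Finset.Nonempty).sup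
      (fun X => (contract p C X).map (fun a : ℤ => ⌈(a : ℚ) / (#X : ℚ)⌉)) =
      (beta p C : WithBot ℤ) := by
  have hcne : (Cᶜ).Nonempty := by
    rw [nonempty_iff_ne_empty]; simpa using hCS
  have hfin : (contract p C Cᶜ).map (fun a : ℤ => ⌈(a : ℚ) / (#Cᶜ : ℚ)⌉) ≠ ⊥ := by
    have := hp.map_univ_ne_bot
    simpa [contract, WithBot.map_eq_bot_iff, union_comm Cᶜ C] using this
  have hle := Finset.le_sup (f := fun X => (contract p C X).map
    (fun a : ℤ => ⌈(a : ℚ) / (#X : ℚ)⌉)) (show Cᶜ ∈ Cᶜ.powerset.filter Finset.Nonempty by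
      simp [hcne])
  have hne := ne_bot_of_le_ne_bot hfin hle
  obtain ⟨b, hb⟩ := WithBot.ne_bot_iff_exists.mp hne
  rw [beta, ← hb, WithBot.unbotD_coe]

/-- For nonempty `X`, `⌈a / |X|⌉ ≤ β` means `a ≤ β |X|`, and subtracting `(β - 1)|X|` leaves `|X|`.
-/
theorem excess_le_card (hp : IsSupermodular p) (hC : p C ≠ ⊥) (hX : X ⊆ Cᶜ) :
    excess p C X ≤ ((#X : ℤ) : WithBot ℤ) := by
  rcases X.eq_empty_or_nonempty with rfl | hne
  · rw [excess_empty hC]; simp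
  have hCS : C ≠ univ := by
    rintro rfl
    obtain ⟨s, hs⟩ := hne
    simpa using hX hs
  have h := Finset.le_sup (f := fun X => (contract p C X).map
    (fun a : ℤ => ⌈(a : ℚ) / (#X : ℚ)⌉))
    (show X ∈ Cᶜ.powerset.filter Finset.Nonempty from mem_filter.2 ⟨mem_powerset.2 hX, hne⟩)
  rw [coe_beta hp hCS] at h
  have hpos : (0 : ℚ) < #X := by exact_mod_cast hne.card_pos
  rw [excess]
  generalize contract p C X = a at h ⊢
  induction a with
  | bot => simp
  | coe a =>
    rw [WithBot.map_coe, WithBot.coe_le_coe] at h ⊢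
    rw [Int.ceil_le, div_le_iff₀ hpos] at h
    have h' : a ≤ beta p C * (#X : ℤ) := by exact_mod_cast h
    linarith

theorem excess_le_peak (hp : IsSupermodular p) (hX : X ⊆ Cᶜ) :
    excess p C X ≤ excess p C (peak p C) := by
  have h := peak_mem_maximizers hp C
  simp only [maximizers, mem_filter, mem_powerset] at h
  exact h.2 X hX

/-- The values `β_i` strictly decrease. -/
theorem beta_union_peak_lt (hp : IsSupermodular p) (hC : p C ≠ ⊥) (hCS : C ∪ peak p C ≠ univ) :
    beta p (C ∪ peak p C) < beta p C := by
  obtain ⟨c, hc⟩ := WithBot.ne_bot_iff_exists.mp hC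
  obtain ⟨d, hd⟩ := WithBot.ne_bot_iff_exists.mp (excess_peak_ne_bot hp C)
  have hle : (beta p (C ∪ peak p C) : WithBot ℤ) ≤ ((beta p C - 1 : ℤ) : WithBot ℤ) := by
    rw [← coe_beta hp hCS]
    refine Finset.sup_le fun X hX => ?_
    rw [mem_filter, mem_powerset, compl_union] at hX
    have hpos : (0 : ℚ) < #X := by exact_mod_cast hX.2.card_pos
    have hXC : X ⊆ Cᶜ := hX.1.trans inter_subset_left
    have hXP : Disjoint X (peak p C) :=
      subset_compl_iff_disjoint_right.1 (hX.1.trans inter_subset_right)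
    -- Adding `X` to the peak cannot raise the excess, so `X` contributes at most `(β - 1)|X|` to
    -- `p`.
    have h := excess_le_peak hp (union_subset hXC (peak_subset_compl p C))
    by_cases hb : contract p (C ∪ peak p C) X = ⊥
    · simp [hb]
    obtain ⟨a, ha⟩ := WithBot.ne_bot_iff_exists.mp hb
    rw [← ha, WithBot.map_coe, WithBot.coe_le_coe, Int.ceil_le, div_le_iff₀ hpos]
    have ha' := (contract_eq_coe_iff (by rw [union_comm]; exact hd.symm)).1 ha.symm
    have e1 : contract p C (X ∪ peak p C) = ((a + d - c : ℤ) : WithBot ℤ) :=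
      contract_eq_coe (by rw [union_assoc, union_comm (peak p C) C]; exact ha') hc.symm
    have e2 : contract p C (peak p C) = ((d - c : ℤ) : WithBot ℤ) :=
      contract_eq_coe hd.symm hc.symm
    rw [excess, excess, e1, e2, WithBot.map_coe, WithBot.map_coe, WithBot.coe_le_coe,
      card_union_of_disjoint hXP] at h
    push_cast at h
    have : a ≤ (beta p C - 1) * (#X : ℤ) := by linarith
    exact_mod_cast this
  rw [WithBot.coe_le_coe] at hle
  omega

theorem chain_succ (p : Finset S → WithBot ℤ) (j : ℕ) :
    chain p (j + 1) = chain p j ∪ part p j := rfl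

theorem disjoint_chain_part (p : Finset S → WithBot ℤ) (j : ℕ) :
    Disjoint (chain p j) (part p j) :=
  subset_compl_iff_disjoint_left.mp (peak_subset_compl p _)

theorem chain_mono (p : Finset S → WithBot ℤ) : Monotone (chain p) :=
  monotone_nat_of_le_succ fun _ => subset_union_left

theorem chain_ne_univ {j : ℕ} (hj : j < numParts p) : chain p j ≠ univ :=
  Nat.notMem_of_lt_sInf (s := {j | chain p j = univ}) hj

theorem value_lt_value (hp : IsSupermodular p) {i j : ℕ} (hij : i < j) (hj : j < numParts p) :
    value p j < value p i := by
  induction j, hij using Nat.le_induction with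
  | base => exact beta_union_peak_lt hp (chain_ne_bot hp i) (chain_ne_univ hj)
  | succ j _ ih =>
    exact (beta_union_peak_lt hp (chain_ne_bot hp j) (chain_ne_univ hj)).trans
      (ih (Nat.lt_of_succ_lt hj))

theorem disjoint_part_of_lt {i j : ℕ} (hij : i < j) : Disjoint (part p i) (part p j) :=
  (disjoint_chain_part p j).mono_left
    ((subset_union_right (s₁ := chain p i)).trans (chain_mono p (Nat.succ_le_of_lt hij)))

theorem disjoint_part {i j : ℕ} (hij : i ≠ j) : Disjoint (part p i) (part p j) := by
  rcases lt_or_gt_of_ne hij with h | h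
  · exact disjoint_part_of_lt h
  · exact (disjoint_part_of_lt h).symm

theorem exists_mem_part_of_mem_chain {s : S} {j : ℕ} (hs : s ∈ chain p j) :
    ∃ i < j, s ∈ part p i := by
  induction j with
  | zero => simp [chain] at hs
  | succ j ih =>
    rcases mem_union.1 hs with hs | hs
    · obtain ⟨i, hi, h⟩ := ih hs
      exact ⟨i, hi.trans j.lt_succ_self, h⟩
    · exact ⟨j, j.lt_succ_self, hs⟩

theorem exists_mem_part (hp : IsSupermodular p) (s : S) : ∃ i < numParts p, s ∈ part p i :=
  exists_mem_part_of_mem_chain (by rw [chain_numParts hp]; exact mem_univ s)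

theorem shift_of_mem_part {s : S} {j : ℕ} (hj : j < numParts p) (hs : s ∈ part p j) :
    shift p s = value p j - 1 := by
  rw [shift, sum_eq_single_of_mem j (mem_range.2 hj), if_pos hs]
  intro i _ hij
  exact if_neg fun hi => disjoint_left.1 (disjoint_part hij) hi hs

theorem sum_eq_sum_part (hp : IsSupermodular p) (f : S → ℝ) (Z : Finset S) :
    ∑ s ∈ Z, f s = ∑ j ∈ range (numParts p), ∑ s ∈ Z ∩ part p j, f s := by
  rw [← sum_biUnion]
  · congr 1
    ext s
    simp only [mem_biUnion, mem_range, mem_inter]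
    refine ⟨fun hs => ?_, fun ⟨_, _, hs, _⟩ => hs⟩
    obtain ⟨i, hi, h⟩ := exists_mem_part hp s
    exact ⟨i, hi, hs, h⟩
  · intro i _ j _ hij
    exact (disjoint_part hij).mono inter_subset_right inter_subset_right

end Chain

/-! ### Splitting the canonical face and `B•` along the partition. -/

section Face

variable {S : Type*} [Fintype S] [DecidableEq S] {p : Finset S → WithBot ℤ}

/-- The canonical face is the direct sum of the base-polyhedra of the functions `p_i`. -/
theorem mem_canonicalFace_iff (hp : IsSupermodular p) {x : S → ℝ} :
    x ∈ canonicalFace p ↔ ∀ j < numParts p,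
      (∀ X ⊆ part p j, ∀ n : ℤ, contract p (chain p j) X = n → (n : ℝ) ≤ ∑ s ∈ X, x s) ∧
      ∃ n : ℤ, contract p (chain p j) (part p j) = n ∧ (n : ℝ) = ∑ s ∈ part p j, x s := by
  simp only [canonicalFace, basePolyhedron, Set.mem_ofPred_eq, map_intCast_le_iff,
    map_intCast_eq_iff]
  constructor
  · rintro ⟨⟨-, hx⟩, hC⟩ j hj
    obtain ⟨c, hc, hcx⟩ := hC j hj.le
    obtain ⟨d, hd, hdx⟩ := hC (j + 1) hj
    refine ⟨fun X hX n hn => ?_, d - c, contract_eq_coe (by rw [union_comm]; exact hd) hc, ?_⟩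
    · rw [contract_eq_coe_iff hc] at hn
      have h := hx _ _ hn
      rw [sum_union ((disjoint_chain_part p j).mono_right hX).symm, ← hcx] at h
      push_cast at h
      linarith
    · rw [chain_succ, sum_union (disjoint_chain_part p j), ← hcx] at hdx
      push_cast
      linarith
  · intro h
    have hC : ∀ j ≤ numParts p, ∃ n : ℤ, p (chain p j) = n ∧ (n : ℝ) = ∑ s ∈ chain p j, x s := by
      intro j
      induction j with
      | zero => exact fun _ => ⟨0, by simp [chain, hp.map_empty], by simp [chain]⟩
      | succ j ih =>
        intro hj
        obtain ⟨c, hc, hcx⟩ := ih (Nat.le_of_succ_le hj)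
        obtain ⟨n, hn, hnx⟩ := (h j hj).2
        rw [contract_eq_coe_iff hc] at hn
        refine ⟨n + c, by rw [chain_succ, union_comm]; exact hn, ?_⟩
        rw [chain_succ, sum_union (disjoint_chain_part p j), ← hcx, ← hnx]
        push_cast
        ring
    have hZ : ∀ j ≤ numParts p, ∀ Z : Finset S, ∀ n : ℤ, p (Z ∩ chain p j) = n →
        (n : ℝ) ≤ ∑ s ∈ Z ∩ chain p j, x s := by
      intro j
      induction j with
      | zero =>
        intro _ Z n hn
        simp only [chain, inter_empty, hp.map_empty, sum_empty] at hn ⊢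
        have : n = 0 := by exact_mod_cast hn.symm
        simp [this]
      | succ j ih =>
        intro hj Z n hn
        obtain ⟨c, hc, hcx⟩ := hC j (Nat.le_of_succ_le hj)
        -- Supermodularity on `Z ∩ C_{j+1}` and `C_j` bounds `p(Z ∩ C_{j+1})` by `p(Z ∩ C_j)` plus
        -- the contracted value at `Z ∩ S_{j+1}`. A finite left side makes both of these finite.
        have hsup := hp.supermodular (Z ∩ chain p (j + 1)) (chain p j)
        have e1 : Z ∩ chain p (j + 1) ∩ chain p j = Z ∩ chain p j := by
          rw [inter_assoc, inter_eq_right.2 (chain_mono p j.le_succ)]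
        have e2 : Z ∩ chain p (j + 1) ∪ chain p j = (Z ∩ part p j) ∪ chain p j := by
          rw [chain_succ]; ext s; simp only [mem_union, mem_inter]; tauto
        rw [e1, e2, hn, hc, ← WithBot.coe_add] at hsup
        have hbot := ne_bot_of_le_ne_bot WithBot.coe_ne_bot hsup
        rw [Ne, WithBot.add_eq_bot, not_or] at hbot
        obtain ⟨a, ha⟩ := WithBot.ne_bot_iff_exists.mp hbot.1
        obtain ⟨b, hb⟩ := WithBot.ne_bot_iff_exists.mp hbot.2
        rw [← ha, ← hb, ← WithBot.coe_add, WithBot.coe_le_coe] at hsup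
        have h1 := ih (Nat.le_of_succ_le hj) Z a ha.symm
        have h2 := (h j hj).1 (Z ∩ part p j) inter_subset_right _
          (contract_eq_coe hb.symm hc)
        rw [chain_succ, inter_union_distrib_left, sum_union
          ((disjoint_chain_part p j).mono inter_subset_right inter_subset_right)]
        have h3 : (n : ℝ) + c ≤ a + b := by exact_mod_cast hsup
        push_cast at h2
        linarith
    refine ⟨⟨?_, fun Z n hn => ?_⟩, hC⟩
    · simpa [chain_numParts hp] using hC _ le_rfl
    · have := hZ _ le_rfl Z n
      rw [chain_numParts hp, inter_univ] at this
      exact this hn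

/-- The translate of `B•` by `-Δ*` is the direct sum of the intersections of the base-polyhedra
of the excess functions with the unit cube. -/
theorem mem_bullet_iff (hp : IsSupermodular p) {y : S → ℝ} :
    (fun s => y s + (shift p s : ℝ)) ∈ bullet p ↔ ∀ j < numParts p,
      (∀ X ⊆ part p j, ∀ n : ℤ, excess p (chain p j) X = n → (n : ℝ) ≤ ∑ s ∈ X, y s) ∧
      (∃ n : ℤ, excess p (chain p j) (part p j) = n ∧ (n : ℝ) = ∑ s ∈ part p j, y s) ∧
      ∀ s ∈ part p j, 0 ≤ y s ∧ y s ≤ 1 := by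
  rw [bullet, Set.mem_inter_iff, mem_canonicalFace_iff hp, canonicalBox, Set.mem_ofPred_eq,
    ← forall₂_and]
  refine forall₂_congr fun j hj => ?_
  rw [and_assoc]
  -- The translation changes `y(X)` by `(β - 1)|X|`, exactly the difference between `contract` and
  -- `excess`.
  have hsum : ∀ X ⊆ part p j, ∑ s ∈ X, (y s + (shift p s : ℝ)) =
      ∑ s ∈ X, y s + ((value p j : ℝ) - 1) * #X := by
    intro X hX
    have h : ∑ s ∈ X, (shift p s : ℝ) = ∑ s ∈ X, ((value p j - 1 : ℤ) : ℝ) :=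
      sum_congr rfl fun s hs => by rw [shift_of_mem_part hj (hX hs)]
    rw [sum_add_distrib, h, sum_const, nsmul_eq_mul]
    push_cast
    ring
  refine and_congr (forall₂_congr fun X hX => ?_) (and_congr ?_ ?_)
  · rw [hsum X hX]
    constructor
    · intro h n hn
      have := h _ (excess_eq_coe_iff.1 hn)
      rw [← value] at this
      push_cast at this
      linarith
    · intro h n hn
      have := h (n - (value p j - 1) * #X) (excess_eq_coe_iff.2 (by rw [hn, ← value]; simp))
      push_cast at this
      linarith
  · rw [hsum _ Subset.rfl]
    constructor
    · rintro ⟨n, hn, h⟩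
      refine ⟨n - (value p j - 1) * #(part p j),
        excess_eq_coe_iff.2 (by rw [hn, ← value]; simp), ?_⟩
      push_cast
      linarith
    · rintro ⟨n, hn, h⟩
      refine ⟨_, excess_eq_coe_iff.1 hn, ?_⟩
      rw [← value]
      push_cast
      linarith
  · refine forall₂_congr fun s hs => ?_
    simp only [shift_of_mem_part hj hs]
    push_cast
    constructor <;> rintro ⟨h1, h2⟩ <;> constructor <;> linarith

end Face

/-! ### Dec-min elements are the integral points of `B•`. -/

section DecMin

theorem le_intCast_iff {a : WithBot ℤ} {m : ℤ} :
    a ≤ (m : WithBot ℤ) ↔ ∀ n : ℤ, a = n → n ≤ m := by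
  induction a with
  | bot => simp
  | coe a => simp only [WithBot.coe_le_coe, WithBot.coe_inj, forall_eq']

variable {S : Type*}

theorem le_sum_of_mem_basePolyhedron [Fintype S] {p : Finset S → WithBot ℤ} {x : S → ℤ}
    (hx : x ∈ intPoints (basePolyhedron p)) {Z : Finset S} {n : ℤ} (hn : p Z = n) : n ≤ ∑ s ∈ Z, x s := by
  have := map_intCast_le_iff.1 (hx.2 Z) n hn
  beta_reduce at this
  exact_mod_cast this

theorem sum_univ_of_mem_basePolyhedron [Fintype S] {p : Finset S → WithBot ℤ} {x : S → ℤ}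
    (hx : x ∈ intPoints (basePolyhedron p)) :
    p univ = ((∑ s, x s : ℤ) : WithBot ℤ) := by
  obtain ⟨n, hn, hn'⟩ := map_intCast_eq_iff.1 hx.1
  rw [hn, WithBot.coe_inj]
  beta_reduce at hn'
  exact_mod_cast hn'

variable [DecidableEq S]

theorem sum_indicator_eq_card (L X : Finset S) :
    ∑ s ∈ X, (if s ∈ L then (1 : ℝ) else 0) = #(L ∩ X) := by
  rw [← sum_filter, sum_const, nsmul_eq_mul, mul_one, filter_mem_eq_inter, inter_comm]

variable [Fintype S] {p : Finset S → WithBot ℤ}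

theorem exists_isLowerBase_part (hp : IsSupermodular p) (j : ℕ) :
    ∃ L, IsLowerBase (excess p (chain p j)) (part p j) L :=
  exists_isLowerBase (excess_supermodular hp _) (excess_empty (chain_ne_bot hp j))
    (fun _ hX => excess_le_card hp (chain_ne_bot hp j) (hX.trans (peak_subset_compl p _)))
    (fun _ hX => excess_le_peak hp (hX.trans (peak_subset_compl p _)))

/-- A 0-1 vector satisfies the translated box constraints automatically, so only the bounds of the
excess functions remain. -/
theorem indicator_add_shift_mem_bullet_iff (hp : IsSupermodular p) {L : Finset S} :
    (fun s => (if s ∈ L then 1 else 0) + shift p s) ∈ intPoints (bullet p) ↔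
      ∀ j < numParts p, IsLowerBase (excess p (chain p j)) (part p j) (L ∩ part p j) := by
  have hcast : (fun s => (((if s ∈ L then 1 else 0) + shift p s : ℤ) : ℝ)) =
      fun s => (if s ∈ L then (1 : ℝ) else 0) + (shift p s : ℝ) := by
    funext s; push_cast; rfl
  rw [intPoints, Set.mem_ofPred_eq, hcast, mem_bullet_iff hp]
  refine forall₂_congr fun j _ => ?_
  simp only [sum_indicator_eq_card, IsLowerBase, MeetsBounds, le_intCast_iff]
  constructor
  · rintro ⟨h1, ⟨n, hn, hn'⟩, -⟩
    refine ⟨inter_subset_right, ?_, fun X hX n hn => ?_⟩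
    · rw [hn, WithBot.coe_inj]; exact_mod_cast hn'
    · rw [inter_assoc, inter_eq_right.2 hX]; exact_mod_cast h1 X hX n hn
  · rintro ⟨-, h1, h2⟩
    refine ⟨fun X hX n hn => ?_, ⟨_, h1, by simp⟩, fun s _ => ?_⟩
    · have := h2 X hX n hn
      rw [inter_assoc, inter_eq_right.2 hX] at this
      exact_mod_cast this
    · split_ifs <;> norm_num

theorem box_of_mem_bullet {x : S → ℤ} (hx : x ∈ intPoints (bullet p)) {j : ℕ}
    (hj : j < numParts p) : ∀ s ∈ part p j, value p j - 1 ≤ x s ∧ x s ≤ value p j := by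
  intro s hs
  have h := hx.2 j hj s hs
  beta_reduce at h
  exact ⟨by exact_mod_cast h.1, by exact_mod_cast h.2⟩

theorem exists_indicator_of_mem_bullet (hp : IsSupermodular p) {m : S → ℤ}
    (hm : m ∈ intPoints (bullet p)) :
    ∃ L : Finset S, m = fun s => (if s ∈ L then 1 else 0) + shift p s := by
  refine ⟨univ.filter fun s => m s = shift p s + 1, funext fun s => ?_⟩
  obtain ⟨j, hj, hs⟩ := exists_mem_part hp s
  have h := box_of_mem_bullet hm hj s hs
  have h' := shift_of_mem_part hj hs
  simp only [mem_filter, mem_univ, true_and]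
  split_ifs <;> omega

/-- A set which is a lower base on every canonical part. -/
theorem exists_union_isLowerBase {F : ℕ → Finset S}
    (hF : ∀ j, IsLowerBase (excess p (chain p j)) (part p j) (F j)) :
    ∃ L : Finset S, ∀ j < numParts p, L ∩ part p j = F j := by
  refine ⟨(range (numParts p)).biUnion F, fun j hj => ?_⟩
  ext s
  simp only [mem_inter, mem_biUnion, mem_range]
  constructor
  · rintro ⟨⟨i, _, hi⟩, hs⟩
    by_cases hij : i = j
    · exact hij ▸ hi
    · exact absurd hs (disjoint_left.1 (disjoint_part hij) ((hF i).1 hi))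
  · exact fun hs => ⟨⟨j, hj, hs⟩, (hF j).1 hs⟩

theorem intPoints_bullet_nonempty (hp : IsSupermodular p) :
    ∃ z, z ∈ intPoints (bullet p) := by
  choose F hF using exists_isLowerBase_part hp
  obtain ⟨L, hL⟩ := exists_union_isLowerBase hF
  exact ⟨_, (indicator_add_shift_mem_bullet_iff hp (L := L)).2 fun j hj => hL j hj ▸ hF j⟩

theorem sum_chain_of_mem_bullet {z : S → ℤ} (hz : z ∈ intPoints (bullet p)) {j : ℕ}
    (hj : j ≤ numParts p) : p (chain p j) = ((∑ s ∈ chain p j, z s : ℤ) : WithBot ℤ) := by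
  obtain ⟨n, hn, hn'⟩ := map_intCast_eq_iff.1 (hz.1.2 j hj)
  rw [hn, WithBot.coe_inj]
  beta_reduce at hn'
  exact_mod_cast hn'

/-- An integral element of `B•` is at most every integral element of the base-polyhedron in the
decreasing order, and strictly smaller than those outside `B•`. -/
theorem bullet_or_lex (hp : IsSupermodular p) {x z : S → ℤ} (hz : z ∈ intPoints (bullet p))
    (hx : x ∈ intPoints (basePolyhedron p)) :
    (x ∈ intPoints (bullet p) ∧ decSort z = decSort x) ∨
      List.Lex (· < ·) (decSort z) (decSort x) := by
  by_cases hlex : List.Lex (· < ·) (decSort z) (decSort x)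
  · exact Or.inr hlex
  refine Or.inl ?_
  -- Equal distributions on `C_j` carry the comparison upward; equal sums turn the bound at
  -- `C_{j+1}` into one on `S_{j+1}` alone.
  have key : ∀ j ≤ numParts p, (∀ l, levelCount z l (chain p j) = levelCount x l (chain p j)) ∧
      ∑ s ∈ chain p j, x s = ∑ s ∈ chain p j, z s ∧
      ∀ i < j, ∀ s ∈ part p i, value p i - 1 ≤ x s ∧ x s ≤ value p i := by
    intro j
    induction j with
    | zero => exact fun _ => ⟨by simp [chain, levelCount], by simp [chain], by simp⟩
    | succ j ih =>
      intro hj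
      obtain ⟨h1, h2, h3⟩ := ih (Nat.le_of_succ_le hj)
      have hd := disjoint_chain_part p j
      have hzb := box_of_mem_bullet hz hj
      -- Elements outside `C_{j+1}` lie in later parts, whose essential values are smaller.
      have hz' : ∀ s ∉ chain p j ∪ part p j, z s < value p j := by
        intro s hs
        obtain ⟨i, hi, hsi⟩ := exists_mem_part hp s
        have hji : j < i := by
          by_contra hcon
          exact hs (chain_mono p (Nat.succ_le_succ (not_lt.1 hcon))
            (mem_union_right (chain p i) hsi))
        exact (box_of_mem_bullet hz hi s hsi).2.trans_lt (value_lt_value hp hji hi)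
      have hsum : ∑ s ∈ part p j, z s ≤ ∑ s ∈ part p j, x s := by
        have := le_sum_of_mem_basePolyhedron hx (sum_chain_of_mem_bullet hz hj)
        rw [chain_succ, sum_union hd, sum_union hd] at this
        linarith
      obtain ⟨hb, hs⟩ := (box_or_lex hd h1 hzb hz' hsum).resolve_right hlex
      refine ⟨fun l => ?_, ?_, fun i hi => ?_⟩
      · rw [chain_succ, levelCount_union _ _ hd, levelCount_union _ _ hd, h1,
          levelCount_eq_of_box hzb hb hs.symm]
      · rw [chain_succ, sum_union hd, sum_union hd, h2, hs]
      · rcases Nat.lt_succ_iff_lt_or_eq.1 hi with hi | rfl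
        · exact h3 i hi
        · exact hb
  refine ⟨⟨⟨hx, fun j hj => ?_⟩, fun j hj s hs => ?_⟩, decSort_eq_of_levelCount ?_⟩
  · rw [sum_chain_of_mem_bullet hz hj, ← (key j hj).2.1, WithBot.map_coe]
    push_cast
    rfl
  · have := (key _ le_rfl).2.2 j hj s hs
    beta_reduce
    exact ⟨by exact_mod_cast this.1, by exact_mod_cast this.2⟩
  · have := (key _ le_rfl).1
    rwa [chain_numParts hp] at this

/-- A dec-min element outside `B•` would be beaten by any integral point of `B•`, and such a point
exists. -/
theorem isDecMin_iff_mem_bullet (hp : IsSupermodular p) {m : S → ℤ} :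
    IsDecMin (intPoints (basePolyhedron p)) m ↔ m ∈ intPoints (bullet p) := by
  constructor
  · rintro ⟨hm, hmin⟩
    obtain ⟨z, hz⟩ := intPoints_bullet_nonempty hp
    rcases bullet_or_lex hp hz hm with h | h
    · exact h.1
    · exact absurd (hmin z hz.1.1) (not_decLE_of_lex h)
  · exact fun hm => ⟨hm.1.1, fun y hy => (bullet_or_lex hp hm hy).imp And.right id⟩

end DecMin

/-! ### Dec-min elements on a single part. -/

section Parts

variable {S : Type*} [Fintype S] [DecidableEq S] {p : Finset S → WithBot ℤ}

theorem mem_partFun_indicator_iff {j : ℕ} {L : Finset S} (hL : L ⊆ part p j) :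
    (fun t : part p j => (if (t : S) ∈ L then 1 else 0) + (value p j - 1)) ∈
        intPoints (basePolyhedron (partFun p j)) ↔
      IsLowerBase (excess p (chain p j)) (part p j) L := by
  have hsum : ∀ X : Finset (part p j),
      ∑ t ∈ X, (((if (t : S) ∈ L then 1 else 0) + (value p j - 1) : ℤ) : ℝ) =
        ((#(L ∩ X.map (Function.Embedding.subtype _)) + (value p j - 1) *
          #(X.map (Function.Embedding.subtype _)) : ℤ) : ℝ) := by
    intro X
    push_cast
    rw [← sum_indicator_eq_card, sum_map, card_map, sum_add_distrib, sum_const, nsmul_eq_mul]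
    exact congrArg₂ _ rfl (mul_comm _ _)
  have huniv : (univ : Finset (part p j)).map (Function.Embedding.subtype _) = part p j := by
    ext s; simp
  simp only [intPoints, basePolyhedron, Set.mem_ofPred_eq, map_intCast_le_iff,
    map_intCast_eq_iff, hsum, partFun, huniv, Int.cast_inj, Int.cast_le, IsLowerBase,
    MeetsBounds, hL, true_and, le_intCast_iff, inter_eq_left.2 hL]
  refine and_congr ?_ ?_
  · rw [excess_eq_coe_iff]
    simp [value]
  · constructor
    · intro h X hX n hn
      have := h (X.subtype (· ∈ part p j)) _ (by
        rw [show (X.subtype (· ∈ part p j)).map (Function.Embedding.subtype _) = X from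
          subtype_map_of_mem hX]
        exact excess_eq_coe_iff.1 hn)
      rw [show (X.subtype (· ∈ part p j)).map (Function.Embedding.subtype _) = X from
          subtype_map_of_mem hX] at this
      rw [← value] at this
      linarith
    · intro h X n hn
      have := h (X.map (Function.Embedding.subtype _))
        (fun s hs => by
          obtain ⟨t, _, rfl⟩ := mem_map.1 hs
          exact t.2)
        (n - (value p j - 1) * #(X.map (Function.Embedding.subtype _)))
        (excess_eq_coe_iff.2 (by rw [hn, ← value]; simp))
      linarith

/-- The comparison of `box_or_lex` with `C = ∅` and `E` the whole part; a lower base supplies the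
competitor in the box. -/
theorem isDecMin_partFun_iff (hp : IsSupermodular p) {j : ℕ} {m : part p j → ℤ} :
    IsDecMin (intPoints (basePolyhedron (partFun p j))) m ↔
      m ∈ intPoints (basePolyhedron (partFun p j)) ∧
        ∀ t, value p j - 1 ≤ m t ∧ m t ≤ value p j := by
  have key : ∀ z ∈ intPoints (basePolyhedron (partFun p j)),
      (∀ t, value p j - 1 ≤ z t ∧ z t ≤ value p j) →
      ∀ x ∈ intPoints (basePolyhedron (partFun p j)),
      ((∀ t, value p j - 1 ≤ x t ∧ x t ≤ value p j) ∧ decSort z = decSort x) ∨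
        List.Lex (· < ·) (decSort z) (decSort x) := by
    intro z hz hzb x hx
    have hsum : ∑ t, x t = ∑ t, z t := by
      rw [← WithBot.coe_inj, ← sum_univ_of_mem_basePolyhedron hx,
        ← sum_univ_of_mem_basePolyhedron hz]
    refine (box_or_lex (C := ∅) (E := univ) (b := value p j) (by simp) (by simp [levelCount])
      (fun t _ => hzb t) (by simp) hsum.ge).imp_left fun h => ?_
    exact ⟨fun t => h.1 t (mem_univ t), decSort_eq_of_levelCount
      (levelCount_eq_of_box (fun t _ => hzb t) h.1 hsum.symm)⟩
  constructor
  · rintro ⟨hm, hmin⟩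
    obtain ⟨L, hL⟩ := exists_isLowerBase_part hp j
    have hz := (mem_partFun_indicator_iff hL.1).2 hL
    refine ⟨hm, ?_⟩
    rcases key _ hz (fun t => by split_ifs <;> omega) m hm with h | h
    · exact h.1
    · exact absurd (hmin _ hz) (not_decLE_of_lex h)
  · exact fun ⟨hm, hb⟩ => ⟨hm, fun y hy => (key m hm hb y hy).imp And.right id⟩

/-- Being in the unit box, a dec-min vector is recovered from its top set `L` as `χ_L + (β - 1)`. -/
theorem mem_topSets_iff (hp : IsSupermodular p) {j : ℕ} {A : Set S} :
    A ∈ topSets p j ↔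
      ∃ L : Finset S, A = L ∧ IsLowerBase (excess p (chain p j)) (part p j) L := by
  classical
  simp only [topSets, isDecMin_partFun_iff hp, Set.mem_ofPred_eq]
  constructor
  · rintro ⟨m, ⟨hm, hb⟩, rfl⟩
    set L : Finset S := univ.filter fun s => ∃ h : s ∈ part p j, m ⟨s, h⟩ = value p j with hLdef
    have hL : L ⊆ part p j := fun s hs => (mem_filter.1 hs).2.1
    refine ⟨L, by ext s; simp [hLdef], (mem_partFun_indicator_iff hL).1 ?_⟩
    convert hm using 2 with t
    have := hb t
    by_cases ht : m t = value p j
    · rw [if_pos (mem_filter.2 ⟨mem_univ _, t.2, ht⟩)]; omega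
    · rw [if_neg fun h => ht (mem_filter.1 h).2.2]; omega
  · rintro ⟨L, rfl, hL⟩
    refine ⟨_, ⟨(mem_partFun_indicator_iff hL.1).2 hL, fun t => by split_ifs <;> omega⟩, ?_⟩
    ext s
    simp only [mem_coe, Set.mem_ofPred_eq]
    constructor
    · exact fun hs => ⟨hL.1 hs, by simp [hs]⟩
    · rintro ⟨_, h⟩
      by_contra hs
      rw [if_neg hs] at h
      omega

end Parts

/-! ### The base-polyhedron of the direct sum. -/

section MatroidPolyhedron

variable {S : Type*}

theorem toNat_eRk_univ {M : Matroid S} {L : Finset S} (hL : M.IsBase (L : Set S)) :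
    (M.eRk Set.univ).toNat = #L := by
  rw [Matroid.eRk_univ_eq, ← hL.encard_eq_eRank, Set.encard_coe_eq_coe_finsetCard]
  rfl

theorem card_inter_le_eRk [DecidableEq S] {M : Matroid S} {L : Finset S} (hL : M.IsBase (L : Set S))
    (Z : Finset S) : #(L ∩ Z) ≤ (M.eRk (Z : Set S)).toNat := by
  have h := (hL.indep.inter_right (Z : Set S)).encard_le_eRk_of_subset Set.inter_subset_right
  rw [← coe_inter, Set.encard_coe_eq_coe_finsetCard] at h
  have htop : M.eRk (Z : Set S) ≠ ⊤ :=
    ne_top_of_le_ne_top (by simp) (M.eRk_le_encard (Z : Set S))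
  simpa using ENat.toNat_le_toNat h htop

variable [Fintype S] [DecidableEq S]

theorem exists_isBase_card_inter_eq_eRk {M : Matroid S} (hE : M.E = Set.univ) (Z : Finset S) :
    ∃ L : Finset S, M.IsBase (L : Set S) ∧ (M.eRk (Z : Set S)).toNat = #(L ∩ Z) := by
  classical
  obtain ⟨I, hI⟩ := M.exists_isBasis (Z : Set S) (by simp [hE])
  obtain ⟨B, hB, rfl⟩ := hI.exists_isBase
  obtain ⟨L, rfl⟩ := (Set.toFinite B).exists_finset_coe
  refine ⟨L, hB, ?_⟩
  rw [hI.eRk_eq_encard, ← coe_inter, Set.encard_coe_eq_coe_finsetCard]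
  rfl

/-- Lower bounds for the elements of a matroid base-polyhedron. -/
theorem exists_isBase_card_inter_le {M : Matroid S} (hE : M.E = Set.univ) {y : S → ℝ}
    (hy : y ∈ matroidBasePolyhedron M) (Z : Finset S) :
    ∃ L : Finset S, M.IsBase (L : Set S) ∧ (#(L ∩ Z) : ℝ) ≤ ∑ s ∈ Z, y s := by
  -- A base attaining the rank of the complement: `y(Z) = |L| - y(Zᶜ) ≥ |L| - |L ∩ Zᶜ|`.
  obtain ⟨L, hL, hr⟩ := exists_isBase_card_inter_eq_eRk hE Zᶜ
  refine ⟨L, hL, ?_⟩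
  have h1 := hy.1
  have h2 := hy.2 Zᶜ
  rw [toNat_eRk_univ hL] at h1
  rw [hr] at h2
  have h3 : #(L ∩ Z) + #(L ∩ Zᶜ) = #L := by
    rw [← sdiff_eq_inter_compl]; exact card_inter_add_card_sdiff L Z
  have h4 : (#(L ∩ Z) : ℝ) + #(L ∩ Zᶜ) = #L := by exact_mod_cast h3
  have h5 := sum_add_sum_compl Z y
  linarith

variable {p : Finset S → WithBot ℤ}

/-- If the bases of `M` are the sets which are lower bases on every canonical part, then the
translate of `B•` by `-Δ*` is the base-polyhedron of `M`. -/
theorem mem_bullet_iff_mem_matroidBasePolyhedron (hp : IsSupermodular p) {M : Matroid S}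
    (hE : M.E = Set.univ)
    (hM : ∀ L : Finset S, M.IsBase (L : Set S) ↔
      ∀ j < numParts p, IsLowerBase (excess p (chain p j)) (part p j) (L ∩ part p j))
    {y : S → ℝ} :
    (fun s => y s + (shift p s : ℝ)) ∈ bullet p ↔ y ∈ matroidBasePolyhedron M := by
  rw [mem_bullet_iff hp]
  constructor
  · intro h
    -- Lower bases dominating `y` on each `Z ∩ S_j` are glued into one base of `M`.
    have key : ∀ Z : Finset S, ∃ L : Finset S, M.IsBase (L : Set S) ∧
        ∑ s ∈ Z, y s ≤ (#(L ∩ Z) : ℝ) := by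
      intro Z
      have hj : ∀ j, ∃ L, IsLowerBase (excess p (chain p j)) (part p j) L ∧
          (j < numParts p → ∑ s ∈ Z ∩ part p j, y s ≤ (#(L ∩ (Z ∩ part p j)) : ℝ)) := by
        intro j
        by_cases hj : j < numParts p
        · obtain ⟨h1, h2, h3⟩ := h j hj
          obtain ⟨L, hL, hle⟩ := exists_isLowerBase_sum_le (excess_supermodular hp _)
            (excess_empty (chain_ne_bot hp j)) (exists_isLowerBase_part hp j)
            (map_intCast_eq_iff.2 h2) (fun X hX => map_intCast_le_iff.2 (h1 X hX))
            (fun s hs => (h3 s hs).2) (fun s hs => (h3 s hs).1)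
            (inter_subset_right : Z ∩ part p j ⊆ part p j)
          exact ⟨L, hL, fun _ => hle⟩
        -- Indices past the last part get any lower base, only so that `F` is defined on all of `ℕ`.
        · obtain ⟨L, hL⟩ := exists_isLowerBase_part hp j
          exact ⟨L, hL, fun h => absurd h hj⟩
      choose F hF hFle using hj
      obtain ⟨L, hL⟩ := exists_union_isLowerBase hF
      refine ⟨L, (hM L).2 fun j hj => hL j hj ▸ hF j, ?_⟩
      rw [← sum_indicator_eq_card, sum_eq_sum_part hp, sum_eq_sum_part hp (fun s => ite _ _ _)]
      refine sum_le_sum fun j hj => ?_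
      have hj := mem_range.1 hj
      rw [sum_indicator_eq_card]
      refine (hFle j hj).trans (le_of_eq ?_)
      rw [← hL j hj, inter_assoc, ← inter_assoc (part p j), inter_comm (part p j) Z, inter_assoc,
        inter_self]
    refine ⟨?_, fun Z => ?_⟩
    · obtain ⟨L, hL, -⟩ := key ∅
      rw [toNat_eRk_univ hL, ← inter_univ L, ← sum_indicator_eq_card, sum_eq_sum_part hp,
        sum_eq_sum_part hp (fun s => ite _ _ _)]
      refine sum_congr rfl fun j hj => ?_
      have hj := mem_range.1 hj
      obtain ⟨n, hn, hn'⟩ := (h j hj).2.1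
      have hb := ((hM L).1 hL j hj).2.1
      rw [hn, WithBot.coe_inj] at hb
      rw [sum_indicator_eq_card, univ_inter, ← hn', hb]
      simp
    · obtain ⟨L, hL, hle⟩ := key Z
      exact hle.trans (by exact_mod_cast card_inter_le_eRk hL Z)
  · intro hy j hj
    have hlow : ∀ X ⊆ part p j, ∀ n : ℤ, excess p (chain p j) X = n →
        (n : ℝ) ≤ ∑ s ∈ X, y s := by
      intro X hX n hn
      obtain ⟨L, hL, hle⟩ := exists_isBase_card_inter_le hE hy X
      have hb := le_intCast_iff.1 (((hM L).1 hL j hj).2.2 X hX) n hn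
      rw [inter_assoc, inter_eq_right.2 hX] at hb
      exact le_trans (by exact_mod_cast hb) hle
    refine ⟨hlow, ?_, fun s _ => ⟨?_, ?_⟩⟩
    -- Every base meets the part in exactly `h(S_j)` elements, so its rank is `h(S_j)` and the upper
    -- bound meets the lower one.
    · obtain ⟨L, hL, hr⟩ := exists_isBase_card_inter_eq_eRk hE (part p j)
      have hb := ((hM L).1 hL j hj).2.1
      refine ⟨_, hb, le_antisymm (hlow _ Subset.rfl _ hb) ?_⟩
      have := hy.2 (part p j)
      rw [hr] at this
      exact_mod_cast this
    · obtain ⟨L, _, hle⟩ := exists_isBase_card_inter_le hE hy {s}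
      rw [sum_singleton] at hle
      exact le_trans (by positivity) hle
    · have h1 := hy.2 {s}
      rw [sum_singleton] at h1
      obtain ⟨L, _, hr⟩ := exists_isBase_card_inter_eq_eRk hE {s}
      rw [hr] at h1
      refine h1.trans ?_
      have : #(L ∩ {s}) ≤ 1 := card_le_card inter_subset_right
      exact_mod_cast this

theorem bullet_eq_translate (hp : IsSupermodular p) {M : Matroid S} (hE : M.E = Set.univ)
    (hM : ∀ L : Finset S, M.IsBase (L : Set S) ↔
      ∀ j < numParts p, IsLowerBase (excess p (chain p j)) (part p j) (L ∩ part p j)) :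
    bullet p = translate (shift p) (matroidBasePolyhedron M) := by
  ext x
  rw [translate, Set.mem_image]
  constructor
  · intro hx
    refine ⟨fun s => x s - shift p s,
      (mem_bullet_iff_mem_matroidBasePolyhedron hp hE hM).1 ?_, by simp⟩
    simpa using hx
  · rintro ⟨y, hy, rfl⟩
    exact (mem_bullet_iff_mem_matroidBasePolyhedron hp hE hM).2 hy

theorem isDecMin_iff_exists_indicator (hp : IsSupermodular p) {M : Matroid S}
    (hM : ∀ L : Finset S, M.IsBase (L : Set S) ↔
      ∀ j < numParts p, IsLowerBase (excess p (chain p j)) (part p j) (L ∩ part p j))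
    {m : S → ℤ} :
    IsDecMin (intPoints (basePolyhedron p)) m ↔
      ∃ L : Finset S, M.IsBase (L : Set S) ∧ m = fun s => (if s ∈ L then 1 else 0) + shift p s := by
  rw [isDecMin_iff_mem_bullet hp]
  constructor
  · intro hm
    obtain ⟨L, rfl⟩ := exists_indicator_of_mem_bullet hp hm
    exact ⟨L, (hM L).2 ((indicator_add_shift_mem_bullet_iff hp).1 hm), rfl⟩
  · rintro ⟨L, hL, rfl⟩
    exact (indicator_add_shift_mem_bullet_iff hp).2 ((hM L).1 hL)

/-- The matroid `M_{j+1}` on the canonical part `S_{j+1}`. -/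
noncomputable def partMatroid (hp : IsSupermodular p) (j : ℕ) : Matroid S :=
  lowerMatroid (excess p (chain p j)) (part p j) (excess_supermodular hp _)
    (exists_isLowerBase_part hp j)

theorem partMatroid_isBase_iff (hp : IsSupermodular p) (j : ℕ) {A : Set S} :
    (partMatroid hp j).IsBase A ↔
      ∃ L : Finset S, A = L ∧ IsLowerBase (excess p (chain p j)) (part p j) L := Iff.rfl

theorem partMatroid_isBase_coe_iff (hp : IsSupermodular p) (j : ℕ) {L : Finset S} :
    (partMatroid hp j).IsBase (L : Set S) ↔
      IsLowerBase (excess p (chain p j)) (part p j) L := by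
  simp [partMatroid_isBase_iff]

theorem iUnion_part (hp : IsSupermodular p) :
    ⋃ i : Fin (numParts p), (part p i : Set S) = Set.univ := by
  refine Set.eq_univ_of_forall fun s => ?_
  obtain ⟨i, hi, hs⟩ := exists_mem_part hp s
  exact Set.mem_iUnion.2 ⟨⟨i, hi⟩, hs⟩

end MatroidPolyhedron

end DecMinBase

/-! ### Assembly over the direct sum of the part matroids. -/

theorem theorem5p5 {S : Type*} [Fintype S] [DecidableEq S] [Nonempty S]
    (p : Finset S → WithBot ℤ) (hp : IsSupermodular p) :
    ∃ (M : Fin (numParts p) → Matroid S)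
      (hM : Pairwise (Function.onFun Disjoint (fun i => (M i).E))),
      -- `M i` is the matroid on the `i`-th canonical part whose bases are the top-level sets
      -- of the dec-min elements of the corresponding base-polyhedron
      (∀ i, (M i).E = (part p i : Set S) ∧
        (∀ L : Set S, (M i).IsBase L ↔ L ∈ topSets p i) ∧
        -- description of the bases by supermodular lower bounds
        (∀ L : Finset S, (M i).IsBase (L : Set S) ↔
          L ⊆ part p i ∧
          excess p (chain p i) (part p i) = ((#L : ℤ) : WithBot ℤ) ∧
          ∀ X ⊆ part p i, excess p (chain p i) X ≤ ((#(L ∩ X) : ℤ) : WithBot ℤ))) ∧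
      -- the ground set of the direct sum is `S`
      (Matroid.disjointSigma M hM).E = Set.univ ∧
      -- characterization of the dec-min elements
      (∀ m : S → ℤ, IsDecMin (intPoints (basePolyhedron p)) m ↔
        ∃ L : Finset S, (Matroid.disjointSigma M hM).IsBase (L : Set S) ∧
          m = fun s => (if s ∈ L then 1 else 0) + shift p s) ∧
      -- `B•` is the translation of the base-polyhedron of the direct sum
      bullet p = translate (shift p) (matroidBasePolyhedron (Matroid.disjointSigma M hM)) ∧
      -- the dec-min elements are the integral elements of `B•`
      {m | IsDecMin (intPoints (basePolyhedron p)) m} = intPoints (bullet p) ∧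
      IsMatroidalMConvex {m | IsDecMin (intPoints (basePolyhedron p)) m} := by
  have hE : ∀ j, (partMatroid hp j).E = (part p j : Set S) := fun _ => rfl
  have hdisj : Pairwise (Function.onFun Disjoint
      (fun i : Fin (numParts p) => (partMatroid hp i).E)) := by
    intro i j hij
    simp only [Function.onFun, hE]
    exact disjoint_coe.2 (disjoint_part fun h => hij (Fin.ext h))
  have hground : (Matroid.disjointSigma (fun i : Fin (numParts p) => partMatroid hp i) hdisj).E =
      Set.univ := by
    rw [Matroid.disjointSigma_ground_eq]
    exact iUnion_part hp
  have hbase : ∀ L : Finset S,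
      (Matroid.disjointSigma (fun i : Fin (numParts p) => partMatroid hp i) hdisj).IsBase
        (L : Set S) ↔
      ∀ j < numParts p, IsLowerBase (excess p (chain p j)) (part p j) (L ∩ part p j) := by
    intro L
    rw [Matroid.disjointSigma_isBase_iff]
    simp only [hE, iUnion_part hp, Set.subset_univ, and_true, ← coe_inter,
      partMatroid_isBase_coe_iff]
    exact ⟨fun h j hj => h ⟨j, hj⟩, fun h i => h i i.2⟩
  have htrans := bullet_eq_translate hp hground hbase
  have hset : {m | IsDecMin (intPoints (basePolyhedron p)) m} = intPoints (bullet p) :=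
    Set.ext fun _ => isDecMin_iff_mem_bullet hp
  exact ⟨fun i => partMatroid hp i, hdisj,
    fun i => ⟨hE i, fun L => (partMatroid_isBase_iff hp i).trans (mem_topSets_iff hp).symm,
      fun L => partMatroid_isBase_coe_iff hp i⟩,
    hground, fun m => isDecMin_iff_exists_indicator hp hbase, htrans, hset,
    _, _, hground, by rw [hset, htrans]⟩
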